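/- Let $(n_k)_{k\ge1}$ be integers with $n_k\ge 2$, let $0<c_k<1$ be real numbers for $k\ge 1$, and let $\eta_{k,j}\ge 0$ be real numbers for $k\ge1$, $0\le j\le n_k$. Let $\Omega_k=\{(i_1,\dots,i_k): 1\le i_j\le n_j \text{ for } 1\le j\le k\}$ for $k\ge0$, so that $\Omega_0=\{\emptyset\}$; for $\sigma\in\Omega_k$ and $1\le j\le n_{k+1}$ let $\sigma * j\in\Omega_{k+1}$ be the word obtained by appending $j$ to $\sigma$. Let $\{J_\sigma : \sigma\in\bigcup_{k\ge0}\Omega_k\}$ be closed intervals with $J_\emptyset=[0,1]$ such that, for all $k\ge 0$ and $\sigma\in\Omega_k$: 1. $J_{\sigma*1},\dots,J_{\sigma*n_{k+1}}$ are subintervals of $J_\sigma$, and $\max J_{\sigma*i}\le\min J_{\sigma*(i+1)}$ for $1\le i\le n_{k+1}-1$; 2. $|J_{\sigma*i}|/|J_\sigma|=c_{k+1}$ for $1\le i\le n_{k+1}$, where $|\cdot|$ denotes length; 3. $\min J_{\sigma*1}-\min J_\sigma=\eta_{k+1,0}$, $\ \max J_\sigma-\max J_{\sigma*n_{k+1}}=\eta_{k+1,n_{k+1}}$,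 and $\min J_{\sigma*(i+1)}-\max J_{\sigma*i}=\eta_{k+1,i}$ for $1\le i\le n_{k+1}-1$. Let $E=\bigcap_{k\ge0}\bigcup_{\sigma\in\Omega_k}J_\sigma$ (such a set is called a homogeneous perfect set), and suppose that the Hausdorff dimension of $E$ is $\dim_H E=1$. Suppose that at least one of the following conditions holds: (A) there is $C\ge1$ such that $\max_{1\le l\le n_k-1}\eta_{k,l}\le C\min_{1\le l\le n_k-1}\eta_{k,l}$ for all $k\ge1$; (B) there is $D>0$ such that $\max_{1\le l\le n_k-1}\eta_{k,l}\le D\,c_1c_2\cdots c_k$ for all $k\ge1$. Then $E$ is quasisymmetrically minimal: $\dim_H f(E)\ge\dim_H E$, that is, $\dim_H f(E)=1$, for every quasisymmetric homeomorphism $f:\mathbb{R}\to\mathbb{R}$. Here a homeomorphism $f:\mathbb{R}\to\mathbb{R}$ is quasisymmetric if there is a homeomorphism $\theta:[0,\infty)\to[0,\infty)$ such that $$\frac{|f(x)-f(a)|}{|f(x)-f(b)|}\le\theta\!\left(\frac{|x-a|}{|x-b|}\right)$$ for all triples $a,b,x$ of distinct points of $\mathbb{R}$. -/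

import Mathlib

open MeasureTheory
open scoped NNReal

/-- A homeomorphism `f : X → Y` of metric spaces is quasisymmetric if there is a homeomorphism
`θ` of `[0, ∞)` with `d(f x, f a) / d(f x, f b) ≤ θ (d(x, a) / d(x, b))` for all triples of
distinct points `a, b, x`. -/
def IsQuasisymmetric {X Y : Type*} [MetricSpace X] [MetricSpace Y] (f : X ≃ₜ Y) : Prop :=
  ∃ θ : ℝ≥0 ≃ₜ ℝ≥0, ∀ a b x : X, a ≠ b → x ≠ a → x ≠ b →
    nndist (f x) (f a) / nndist (f x) (f b) ≤ θ (nndist x a / nndist x b)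

/-- A subset `E` of the line is (1-dimensionally) quasisymmetrically minimal if
`dim_H f(E) ≥ dim_H E` for every quasisymmetric homeomorphism `f : ℝ → ℝ`. -/
def IsQuasisymmetricallyMinimal (E : Set ℝ) : Prop :=
  ∀ f : ℝ ≃ₜ ℝ, IsQuasisymmetric f → dimH E ≤ dimH (f '' E)

namespace HomogeneousPerfect

/-- The words `σ = (σ₁, …, σ_k)` of length `k` with `1 ≤ σ_j ≤ n_j`. The list position `j`
(counted from `0`) holds the letter `σ_{j+1}`. -/
def words (n : ℕ → ℕ) (k : ℕ) : Set (List ℕ) :=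
  {σ | σ.length = k ∧ ∀ (j : ℕ) (hj : j < σ.length), 1 ≤ σ[j] ∧ σ[j] ≤ n (j + 1)}

/-- The length of a compact interval. -/
def len (I : NonemptyInterval ℝ) : ℝ := I.snd - I.fst

/-- The family of closed intervals `J σ` fulfils the homogeneous perfect structure with
parameters `n k`, `c k` (`k ≥ 1`) and `η k j` (`k ≥ 1`, `0 ≤ j ≤ n k`). The values of the
sequences at `k = 0`, of `η k j` for `j > n k`, and of `J` at other lists are irrelevant. -/
structure IsStructure (n : ℕ → ℕ) (c : ℕ → ℝ) (η : ℕ → ℕ → ℝ)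
    (J : List ℕ → NonemptyInterval ℝ) : Prop where
  two_le_n : ∀ k, 1 ≤ k → 2 ≤ n k
  c_pos : ∀ k, 1 ≤ k → 0 < c k
  c_lt_one : ∀ k, 1 ≤ k → c k < 1
  gap_nonneg : ∀ k j, 1 ≤ k → j ≤ n k → 0 ≤ η k j
  /-- `J_∅ = [0, 1]` -/
  root_fst : (J []).fst = 0
  root_snd : (J []).snd = 1
  /-- children are subintervals of their parent -/
  subset : ∀ k, ∀ σ ∈ words n k, ∀ i, 1 ≤ i → i ≤ n (k + 1) →
    Set.Icc (J (σ ++ [i])).fst (J (σ ++ [i])).snd ⊆ Set.Icc (J σ).fst (J σ).snd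
  /-- children are arranged from left to right with disjoint interiors -/
  ordered : ∀ k, ∀ σ ∈ words n k, ∀ i, 1 ≤ i → i + 1 ≤ n (k + 1) →
    (J (σ ++ [i])).snd ≤ (J (σ ++ [i + 1])).fst
  ratio : ∀ k, ∀ σ ∈ words n k, ∀ i, 1 ≤ i → i ≤ n (k + 1) →
    len (J (σ ++ [i])) / len (J σ) = c (k + 1)
  gap_left : ∀ k, ∀ σ ∈ words n k, (J (σ ++ [1])).fst - (J σ).fst = η (k + 1) 0
  gap_right : ∀ k, ∀ σ ∈ words n k,
    (J σ).snd - (J (σ ++ [n (k + 1)])).snd = η (k + 1) (n (k + 1))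
  gap_interior : ∀ k, ∀ σ ∈ words n k, ∀ i, 1 ≤ i → i + 1 ≤ n (k + 1) →
    (J (σ ++ [i + 1])).fst - (J (σ ++ [i])).snd = η (k + 1) i

/-- `E_k`, the union of the basic intervals of order `k`. -/
def level (n : ℕ → ℕ) (J : List ℕ → NonemptyInterval ℝ) (k : ℕ) : Set ℝ :=
  ⋃ σ ∈ words n k, Set.Icc (J σ).fst (J σ).snd

/-- The homogeneous perfect set `E = ⋂_k E_k`. -/
def limitSet (n : ℕ → ℕ) (J : List ℕ → NonemptyInterval ℝ) : Set ℝ :=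
  ⋂ k : ℕ, level n J k

/-- Condition (A): there is `C ≥ 1` such that for all `k ≥ 1` the maximum of the interior gaps
`η k l`, `1 ≤ l ≤ n k - 1`, is at most `C` times their minimum. -/
def GapsComparable (n : ℕ → ℕ) (η : ℕ → ℕ → ℝ) : Prop :=
  ∃ C : ℝ, 1 ≤ C ∧ ∀ k, 1 ≤ k → ∀ l l', 1 ≤ l → l < n k → 1 ≤ l' → l' < n k →
    η k l ≤ C * η k l'

/-- Condition (B): there is `D > 0` such that for all `k ≥ 1` the maximum of the interior gaps
`η k l`, `1 ≤ l ≤ n k - 1`, is at most `D c₁ ⋯ c_k`. -/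
def GapsDominated (n : ℕ → ℕ) (c : ℕ → ℝ) (η : ℕ → ℕ → ℝ) : Prop :=
  ∃ D : ℝ, 0 < D ∧ ∀ k, 1 ≤ k → ∀ l, 1 ≤ l → l < n k →
    η k l ≤ D * ∏ i ∈ Finset.Icc 1 k, c i

end HomogeneousPerfect

/-! Each basic interval is replaced by the convex hull of the part of $E$ inside it, which removes
the outer gaps at every level. The hulls of order $k$ have a common length $h_k$, the outermost
children of a hull reach its ends, and (A) or (B) becomes one condition: the gaps of order $k$ lie
between some $s_k\ge 0$ and $D(h_k+s_k)$ (`exists_gap_bounds`). Write $N_k=n_1\cdots n_k$. Since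
$\dim_H E=1$, $N_kh_k^t$ is bounded below for every $t<1$ (`exists_le_card_mul_rpow`).

Let $F$ be the map, made increasing, and let $d<1$. A mass distribution argument bounds the
$d$-dimensional content of $F(E)$ from below. Give a hull $J$ of order $k$ the mass $a_k|F(J)|^d$,
and divide it among the blocks, a block being a child together with the gap to its right, in
proportion to the lengths of their images. Two competing effects decide whether the mass of each
child dominates its share. The Hölder bound $|F(J')|\le (h_{k+1}/h_k)^p|F(J)|$ for a child $J'$
gives a gain $(h_k/h_{k+1})^P$ with $P=p(1-d)$. Adjoining the gap costs at most
$(h_k/h_{k+1})^{P/2}\,(h_k/(n_{k+1}h_{k+1}))^K$ (`exists_gap_loss`). The second factor telescopes to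
$(h_0/(N_kh_k))^K$, which dimension $1$ keeps below a small negative power of $h_k$, so half of the
gain pays for it. This determines the weights $a_k$, and they stay bounded.

A covering interval of length between $h_{k+1}$ and $h_k$ is compared with the blocks that it meets
(`sum_blocks_le`, `image_le_of_meets`), and it meets hulls of order $k$ of total length at most
$3h_k$. Summing over a finite cover bounds its content from below (`le_load`, `load_root_le`). Hence
$\dim_H F(E)\ge d$ for every $d<1$. -/

/-! ### Quasisymmetric maps of the line as increasing maps -/

/-- A self-homeomorphism of `[0, ∞)` is increasing. -/
theorem NNReal.strictMono_homeomorph (θ : ℝ≥0 ≃ₜ ℝ≥0) : StrictMono θ := by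
  rcases θ.continuous.strictMono_of_inj θ.injective with h | h
  · exact h
  · exfalso
    obtain ⟨z, hz⟩ := θ.surjective (θ 0 + 1)
    have h1 : θ z ≤ θ 0 := h.antitone (zero_le (a := z))
    rw [hz] at h1
    exact absurd h1 (not_le.2 (lt_add_one _))

theorem NNReal.homeomorph_zero (θ : ℝ≥0 ≃ₜ ℝ≥0) : θ 0 = 0 := by
  obtain ⟨z, hz⟩ := θ.surjective 0
  have h1 : θ 0 ≤ θ z := (NNReal.strictMono_homeomorph θ).monotone (zero_le (a := z))
  rw [hz] at h1
  exact le_antisymm h1 (zero_le (a := _))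

/-- A decreasing map is composed with the reflection $x\mapsto -x$, an isometry, which affects
neither the distortion nor the dimension. -/
theorem IsQuasisymmetric.exists_strictMono {f : ℝ ≃ₜ ℝ} (hf : IsQuasisymmetric f) :
    ∃ g : ℝ ≃ₜ ℝ, StrictMono g ∧ IsQuasisymmetric g ∧
      ∀ S : Set ℝ, dimH (g '' S) = dimH (f '' S) := by
  rcases f.continuous.strictMono_of_inj f.injective with h | h
  · exact ⟨f, h, hf, fun _ => rfl⟩
  · refine ⟨f.trans (Homeomorph.neg ℝ), fun a b hab => ?_, ?_, fun S => ?_⟩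
    · simpa using h hab
    · obtain ⟨θ, hθ⟩ := hf
      refine ⟨θ, fun a b x h1 h2 h3 => ?_⟩
      simpa using hθ a b x h1 h2 h3
    · have : (f.trans (Homeomorph.neg ℝ)) '' S = (fun x : ℝ => -x) '' (f '' S) := by
        rw [Set.image_image]; rfl
      rw [this]
      exact (IsometryEquiv.neg ℝ).isometry.dimH_image _

/-- The three-point condition for adjacent intervals: `ω` controls how an increasing map distorts
the ratio of the lengths of two adjacent intervals. -/
structure AdjacentControl (F : ℝ → ℝ) (ω : ℝ → ℝ) : Prop where
  mono : StrictMono F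
  pos : ∀ t, 0 < t → 0 < ω t
  small : ∀ δ, 0 < δ → ∃ τ, 0 < τ ∧ ω τ ≤ δ
  right : ∀ x r r' t, 0 ≤ r → 0 < r' → r ≤ t * r' → F (x + r) - F x ≤ ω t * (F x - F (x - r'))
  left : ∀ x r r' t, 0 ≤ r → 0 < r' → r ≤ t * r' → F x - F (x - r) ≤ ω t * (F (x + r') - F x)

theorem IsQuasisymmetric.exists_adjacentControl {g : ℝ ≃ₜ ℝ} (hg : IsQuasisymmetric g)
    (hm : StrictMono g) : ∃ ω, AdjacentControl g ω := by
  obtain ⟨θ, hθ⟩ := hg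
  have hθm := NNReal.strictMono_homeomorph θ
  have hθ0 := NNReal.homeomorph_zero θ
  have key : ∀ a b x : ℝ, a ≠ b → x ≠ a → x ≠ b → ∀ t : ℝ, |x - a| ≤ t * |x - b| →
      |g x - g a| ≤ θ t.toNNReal * |g x - g b| := by
    intro a b x h1 h2 h3 t ht
    have hb : 0 < |x - b| := abs_pos.2 (sub_ne_zero.2 h3)
    have hgb : 0 < |g x - g b| := abs_pos.2 (sub_ne_zero.2 (g.injective.ne h3))
    have h4 := hθ a b x h1 h2 h3
    have h5 : nndist x a / nndist x b ≤ t.toNNReal := by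
      rw [← NNReal.coe_le_coe]
      push_cast
      rw [← Real.dist_eq, ← Real.dist_eq] at *
      rw [div_le_iff₀ hb]
      exact ht.trans (mul_le_mul_of_nonneg_right (le_max_left _ _) hb.le)
    have h6 := h4.trans (hθm.monotone h5)
    rw [← NNReal.coe_le_coe] at h6
    push_cast at h6
    rw [Real.dist_eq, Real.dist_eq, div_le_iff₀ hgb] at h6
    exact h6
  refine ⟨fun t => θ t.toNNReal, hm, ?_, ?_, ?_, ?_⟩
  · intro t ht
    have h1 : (0 : ℝ≥0) < t.toNNReal := Real.toNNReal_pos.2 ht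
    have := hθm h1
    rw [hθ0] at this
    exact_mod_cast this
  · intro δ hδ
    have h1 : (0 : ℝ≥0) < θ.symm δ.toNNReal := by
      rw [pos_iff_ne_zero]
      intro h
      have h2 : θ (θ.symm δ.toNNReal) = 0 := by rw [h, hθ0]
      rw [θ.apply_symm_apply, Real.toNNReal_eq_zero] at h2
      linarith
    -- Since `θ` fixes $0$ and is onto, small distortion is attained at a positive ratio.
    refine ⟨θ.symm δ.toNNReal, by exact_mod_cast h1, ?_⟩
    rw [Real.toNNReal_coe, θ.apply_symm_apply, Real.coe_toNNReal _ hδ.le]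
  · intro x r r' t hr hr' h
    have h2 : 0 ≤ g x - g (x - r') := sub_nonneg.2 (hm.monotone (by linarith))
    rcases hr.eq_or_lt with rfl | hr
    · simpa using mul_nonneg (NNReal.coe_nonneg _) h2
    · have h1 : 0 ≤ g (x + r) - g x := sub_nonneg.2 (hm.monotone (by linarith))
      have := key (x + r) (x - r') x (by linarith) (by linarith) (by linarith) t
        (by rw [sub_sub_cancel, abs_of_pos hr', show x - (x + r) = -r by ring, abs_neg,
              abs_of_pos hr]; exact h)
      rwa [abs_of_nonneg h2, abs_sub_comm, abs_of_nonneg h1] at this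
  · intro x r r' t hr hr' h
    have h2 : 0 ≤ g (x + r') - g x := sub_nonneg.2 (hm.monotone (by linarith))
    rcases hr.eq_or_lt with rfl | hr
    · simpa using mul_nonneg (NNReal.coe_nonneg _) h2
    · have h1 : 0 ≤ g x - g (x - r) := sub_nonneg.2 (hm.monotone (by linarith))
      have := key (x - r) (x + r') x (by linarith) (by linarith) (by linarith) t
        (by rw [sub_sub_cancel, abs_of_pos hr, show x - (x + r') = -r' by ring, abs_neg,
              abs_of_pos hr']; exact h)
      rwa [abs_of_nonneg h1, abs_sub_comm, abs_of_nonneg h2] at this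

/-! ### Power bounds: growth and Hölder estimates -/

namespace AdjacentControl

variable {F ω : ℝ → ℝ}

/-- Each doubling of an interval multiplies its image by at most `B`, and about $\log_2(1+r/r')$
doublings suffice, whence $q=\log_2 B$. -/
theorem exists_growth (hF : AdjacentControl F ω) :
    ∃ C q : ℝ, 1 ≤ C ∧ 1 ≤ q ∧ ∀ x r r', 0 ≤ r → 0 < r' →
      F (x + r) - F x ≤ C * (1 + r / r') ^ q * (F x - F (x - r')) := by
  set B : ℝ := max 2 (1 + ω 1) with hB
  have hB2 : 2 ≤ B := le_max_left _ _
  have hBw : 1 + ω 1 ≤ B := le_max_right _ _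
  have hB0 : 0 < B := by linarith
  have dbl : ∀ m : ℕ, ∀ x r : ℝ, 0 < r → F (x + 2 ^ m * r) - F x ≤ B ^ m * (F (x + r) - F x) := by
    intro m
    induction m with
    | zero => intro x r _; simp
    | succ m ih =>
      intro x r hr
      have h1 := ih x r hr
      have hr2 : 0 < 2 ^ m * r := by positivity
      have h2 := hF.right (x + 2 ^ m * r) (2 ^ m * r) (2 ^ m * r) 1 hr2.le hr2 (by linarith)
      rw [add_sub_cancel_right] at h2
      have h3 : x + 2 ^ (m + 1) * r = x + 2 ^ m * r + 2 ^ m * r := by ring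
      have h4 : 0 ≤ F (x + 2 ^ m * r) - F x := sub_nonneg.2 (hF.mono.monotone (by linarith))
      rw [h3, pow_succ]
      nlinarith
  refine ⟨max 1 (ω 1 * B), Real.logb 2 B, le_max_left _ _, ?_, ?_⟩
  · rw [Real.le_logb_iff_rpow_le (by norm_num) hB0]
    simpa using hB2
  · intro x r r' hr hr'
    have hy : 0 ≤ F x - F (x - r') := sub_nonneg.2 (hF.mono.monotone (by linarith))
    have ht1 : 1 ≤ 1 + r / r' := by have := div_nonneg hr hr'.le; linarith
    obtain ⟨m, hm1, hm2⟩ := exists_nat_pow_near ht1 (show (1 : ℝ) < 2 by norm_num)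
    have h1 : F (x + r) - F x ≤ F (x + 2 ^ (m + 1) * r') - F x := by
      have : x + r ≤ x + 2 ^ (m + 1) * r' := by
        have h5 : r / r' * r' = r := div_mul_cancel₀ _ hr'.ne'
        nlinarith
      linarith [hF.mono.monotone this]
    have h2 := dbl (m + 1) x r' hr'
    have h3 := hF.right x r' r' 1 hr'.le hr' (by linarith)
    have h4 : B ^ m ≤ (1 + r / r') ^ Real.logb 2 B := by
      have h5 : (B : ℝ) ^ m = ((2 : ℝ) ^ m) ^ Real.logb 2 B := by
        rw [← Real.rpow_natCast 2 m, ← Real.rpow_mul (by norm_num), mul_comm, Real.rpow_mul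
          (by norm_num), Real.rpow_logb (by norm_num) (by norm_num) hB0, Real.rpow_natCast]
      rw [h5]
      exact Real.rpow_le_rpow (by positivity) hm1
        (Real.logb_nonneg (by norm_num) (by linarith))
    have hw := hF.pos 1 one_pos
    calc F (x + r) - F x ≤ B ^ (m + 1) * (ω 1 * (F x - F (x - r'))) :=
          h1.trans (h2.trans (mul_le_mul_of_nonneg_left h3 (by positivity)))
      _ = (ω 1 * B) * B ^ m * (F x - F (x - r')) := by ring
      _ ≤ _ := by
          refine mul_le_mul_of_nonneg_right (mul_le_mul (le_max_right _ _) h4 (by positivity)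
            (le_max_of_le_left zero_le_one)) hy

/-- The complement of the small interval is at least as long as the interval, so one of its two
sides has at least half that length; the three-point condition with ratio $2$ applies on that side.
-/
theorem half_le (hF : AdjacentControl F ω) {a a' b b' : ℝ} (ha : a < a') (hb : b ≤ a)
    (hb' : a' ≤ b') (h : 2 * (a' - a) ≤ b' - b) :
    F a' - F a ≤ ω 2 / (1 + ω 2) * (F b' - F b) := by
  have hw := hF.pos 2 two_pos
  rw [div_mul_eq_mul_div, le_div_iff₀ (by linarith)]
  have hx := hF.mono ha
  have h1 := hF.mono.monotone hb
  have h2 := hF.mono.monotone hb'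
  rcases le_total (a' - a) (2 * (b' - a')) with h3 | h3
  · have := hF.left a' (a' - a) (b' - a') 2 (by linarith) (by linarith) h3
    simp only [sub_sub_cancel, add_sub_cancel] at this
    nlinarith
  · have := hF.right a (a' - a) (a - b) 2 (by linarith) (by linarith) (by linarith)
    simp only [sub_sub_cancel, add_sub_cancel] at this
    nlinarith

theorem pow_le (hF : AdjacentControl F ω) (m : ℕ) : ∀ {a a' b b' : ℝ}, a < a' → b ≤ a →
    a' ≤ b' → 2 ^ m * (a' - a) ≤ b' - b →
    F a' - F a ≤ (ω 2 / (1 + ω 2)) ^ m * (F b' - F b) := by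
  have hw := hF.pos 2 two_pos
  induction m with
  | zero =>
    intro a a' b b' ha hb hb' _
    have h1 := hF.mono.monotone hb
    have h2 := hF.mono.monotone hb'
    simp only [pow_zero, one_mul]
    linarith
  | succ m ih =>
    intro a a' b b' ha hb hb' h
    have hp : (1 : ℝ) ≤ 2 ^ m := one_le_pow₀ (by norm_num)
    rw [pow_succ] at h
    -- Left end of an intermediate interval of half the outer length, placed so that it contains
    -- $[a,a']$ and stays in $[b,b']$.
    set l : ℝ := min a ((b + b') / 2) with hl
    have hl1 : l ≤ a := min_le_left _ _
    have hl2 : l ≤ (b + b') / 2 := min_le_right _ _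
    have hlen : 0 < b' - b := by linarith
    have hl3 : b ≤ l := le_min hb (by linarith)
    have hl4 : a' ≤ l + (b' - b) / 2 := by
      rcases min_choice a ((b + b') / 2) with h5 | h5 <;> rw [hl, h5]
      · nlinarith
      · linarith
    have h1 := ih ha hl1 hl4 (by linarith)
    have h2 := hF.half_le (a := l) (a' := l + (b' - b) / 2) (b := b) (b' := b') (by linarith) hl3
      (by linarith) (by linarith)
    rw [pow_succ, mul_assoc]
    exact h1.trans (mul_le_mul_of_nonneg_left h2 (by positivity))

theorem exists_holder (hF : AdjacentControl F ω) :
    ∃ p : ℝ, 0 < p ∧ p ≤ 1 ∧ ∀ a a' b b' : ℝ, a < a' → b ≤ a → a' ≤ b' →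
      2 * (a' - a) ≤ b' - b → F a' - F a ≤ ((a' - a) / (b' - b)) ^ p * (F b' - F b) := by
  have hw := hF.pos 2 two_pos
  set ρ := ω 2 / (1 + ω 2) with hρ
  have hρ0 : 0 < ρ := by positivity
  have hρ1 : ρ < 1 := by rw [hρ, div_lt_one (by linarith)]; linarith
  have hlog : 0 < - Real.logb 2 ρ := by
    have := Real.logb_neg (b := 2) (by norm_num) hρ0 hρ1
    linarith
  -- Half of $-\log_2\rho$ absorbs the rounding to whole halvings: $m\ge1$ gives $m+1\le 2m$.
  refine ⟨min 1 (- Real.logb 2 ρ / 2), by positivity, min_le_left _ _, ?_⟩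
  intro a a' b b' ha hb hb' h
  have hlen : 0 < b' - b := by linarith
  have ha0 : 0 < a' - a := by linarith
  have hR : 1 ≤ (b' - b) / (a' - a) := by rw [le_div_iff₀ ha0]; linarith
  obtain ⟨m, hm1, hm2⟩ := exists_nat_pow_near hR (show (1 : ℝ) < 2 by norm_num)
  have hm : 1 ≤ m := by
    by_contra hm
    have : m = 0 := by omega
    subst this
    rw [zero_add, pow_one, div_lt_iff₀ ha0] at hm2
    linarith
  rw [le_div_iff₀ ha0] at hm1
  refine (hF.pow_le m ha hb hb' hm1).trans (mul_le_mul_of_nonneg_right ?_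
    (sub_nonneg.2 (hF.mono.monotone (by linarith))))
  have hq0 : 0 < (a' - a) / (b' - b) := by positivity
  have hq1 : (a' - a) / (b' - b) ≤ 1 := by rw [div_le_one hlen]; linarith
  refine le_trans ?_ (Real.rpow_le_rpow_of_exponent_ge hq0 hq1 (min_le_right _ _))
  have h2 : ((2 : ℝ) ^ (m + 1))⁻¹ ≤ (a' - a) / (b' - b) := by
    rw [div_lt_iff₀ ha0] at hm2
    rw [inv_le_comm₀ (by positivity) hq0, inv_div, div_le_iff₀ ha0]
    exact hm2.le
  refine le_trans ?_ (Real.rpow_le_rpow (by positivity) h2 (by positivity))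
  have h3 : ρ ^ m = ((2 : ℝ) ^ (2 * m))⁻¹ ^ (- Real.logb 2 ρ / 2) := by
    rw [← Real.rpow_natCast 2 (2 * m), ← Real.rpow_neg (by norm_num), ← Real.rpow_mul (by norm_num)]
    rw [show -((2 * m : ℕ) : ℝ) * (-Real.logb 2 ρ / 2) = Real.logb 2 ρ * m by push_cast; ring,
      Real.rpow_mul (by norm_num), Real.rpow_logb (by norm_num) (by norm_num) hρ0,
      Real.rpow_natCast]
  rw [h3]
  refine Real.rpow_le_rpow (by positivity) ?_ (by positivity)
  exact inv_anti₀ (by positivity) (pow_le_pow_right₀ (by norm_num) (by omega))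

end AdjacentControl

/-! ### The cost of adjoining a gap -/

/-- Adjoining to an interval of length `h'` an adjacent gap enlarges its image by a factor which is
controlled by the ratio `h / h'` and by the density `n * h' / h`. -/
theorem AdjacentControl.exists_gap_loss {F ω : ℝ → ℝ} (hF : AdjacentControl F ω) {C q D ε : ℝ}
    (hC : 1 ≤ C) (hq : 1 ≤ q) (hD : 0 ≤ D) (hε : 0 < ε)
    (hgr : ∀ x r r', 0 ≤ r → 0 < r' →
      F (x + r) - F x ≤ C * (1 + r / r') ^ q * (F x - F (x - r'))) :
    ∃ K, q ≤ K ∧ ∀ (n : ℕ) (h' h s gap b : ℝ), 2 ≤ n → 0 < h' → 0 ≤ s → 0 ≤ gap →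
      gap ≤ D * (h' + s) → n * h' + gap ≤ h → n * h' + (n - 1) * s ≤ h →
      F (b + gap) - F (b - h') ≤ (h / h') ^ ε * (h / (n * h')) ^ K * (F b - F (b - h')) := by
  set A : ℝ := (1 + C) * (1 + 2 * D) ^ q with hA
  have hDq : 1 ≤ (1 + 2 * D) ^ q := Real.one_le_rpow (by linarith) (by linarith)
  have hA1 : 1 ≤ A := one_le_mul_of_one_le_of_one_le (by linarith) hDq
  have hA0 : 0 < A := by linarith
  have h2e : 0 < (2 : ℝ) ^ ε - 1 := by
    have := Real.one_lt_rpow (show (1 : ℝ) < 2 by norm_num) hε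
    linarith
  -- A gap of relative size at most `τ` costs at most $2^\varepsilon$, which $(h/h')^\varepsilon$
  -- covers because $h\ge 2h'$.
  obtain ⟨τ, hτ0, hτ⟩ := hF.small _ h2e
  set M : ℝ := A ^ (1 / ε) with hM
  have hM0 : 0 < M := Real.rpow_pos_of_pos hA0 _
  have hb2 : 1 < 1 + τ / M := by have := div_pos hτ0 hM0; linarith
  have h2q : (1 : ℝ) ≤ 2 ^ q := Real.one_le_rpow (by norm_num) (by linarith)
  set K₁ : ℝ := Real.logb (3 / 2) (A * 2 ^ q) with hK₁
  set K₂ : ℝ := Real.logb (1 + τ / M) A with hK₂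
  have hK₁0 : 0 ≤ K₁ := Real.logb_nonneg (by norm_num) (by nlinarith)
  have hK₂0 : 0 ≤ K₂ := Real.logb_nonneg hb2 hA1
  refine ⟨q + K₁ + K₂, by linarith, ?_⟩
  intro n h' h s gap b hn hh' hs hg hgD hgh hsh
  have hn' : (2 : ℝ) ≤ n := by exact_mod_cast hn
  have hx : 0 ≤ F b - F (b - h') := sub_nonneg.2 (hF.mono.monotone (by linarith))
  have hR2 : 2 ≤ h / h' := by 
    rw [le_div_iff₀ hh']
    linarith [mul_le_mul_of_nonneg_right hn' hh'.le]
  have hn0 : 0 < n * h' := by positivity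
  have hr1 : 1 ≤ h / (n * h') := by rw [le_div_iff₀ hn0]; linarith
  have hRe : 1 ≤ (h / h') ^ ε := Real.one_le_rpow (by linarith) hε.le
  have hrK : 1 ≤ (h / (n * h')) ^ (q + K₁ + K₂) := Real.one_le_rpow hr1 (by linarith)
  have hgrow := hgr b gap h' hg hh'
  have hgh' : 0 ≤ gap / h' := by positivity
  have hfin : ∀ u T : ℝ, F (b + gap) - F b ≤ u * (F b - F (b - h')) → 1 + u ≤ T →
      F (b + gap) - F (b - h') ≤ T * (F b - F (b - h')) := fun u T h1 h2 => by
    have h3 := mul_le_mul_of_nonneg_right h2 hx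
    rw [add_mul, one_mul] at h3
    linarith
  -- If $s\ge h'$, the gaps alone force $h/(nh')\ge 1+s/(2h')\ge 3/2$, because $n-1\ge n/2$. A power
  -- of this pays for the polynomial growth, and `K₁` pays for the constants.
  rcases le_total h' s with hcase | hcase
  · have ht : 1 ≤ s / h' := by rwa [le_div_iff₀ hh', one_mul]
    have h1 : 1 + gap / h' ≤ (1 + 2 * D) * (s / h') := by
      have : gap / h' ≤ D * (1 + s / h') := by
        rw [div_le_iff₀ hh', mul_assoc, add_mul, div_mul_cancel₀ _ hh'.ne', one_mul]
        exact hgD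
      linarith [mul_le_mul_of_nonneg_left ht hD]
    have h2 : (1 + gap / h') ^ q ≤ (1 + 2 * D) ^ q * (s / h') ^ q := by
      rw [← Real.mul_rpow (by linarith) (by linarith)]
      exact Real.rpow_le_rpow (by positivity) h1 (by linarith)
    have h3 : 1 ≤ (s / h') ^ q := Real.one_le_rpow ht (by linarith)
    have h4 : 1 + C * (1 + gap / h') ^ q ≤ A * (s / h') ^ q := by
      have : 1 ≤ (1 + 2 * D) ^ q * (s / h') ^ q := one_le_mul_of_one_le_of_one_le hDq h3
      have h3' := mul_le_mul_of_nonneg_left h2 (show 0 ≤ C by linarith)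
      rw [hA, mul_assoc, add_mul]
      linarith
    set w : ℝ := 1 + s / h' / 2 with hw
    have hw32 : 3 / 2 ≤ w := by linarith
    have h5 : (s / h') ^ q ≤ 2 ^ q * w ^ q := by
      rw [← Real.mul_rpow (by norm_num) (by linarith)]
      exact Real.rpow_le_rpow (by linarith) (by linarith) (by linarith)
    have h6 : w ≤ h / (n * h') := by
      rw [le_div_iff₀ hn0]
      have h6' : w * (n * h') = n * h' + n * s / 2 := by rw [hw]; field_simp
      have h6'' : 0 ≤ (n - 2) * s := mul_nonneg (by linarith) hs
      linarith
    have h7 : A * 2 ^ q ≤ w ^ (K₁ + K₂) := by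
      calc A * 2 ^ q = (3 / 2) ^ K₁ := by
            rw [hK₁, Real.rpow_logb (by norm_num) (by norm_num) (by positivity)]
        _ ≤ w ^ K₁ := Real.rpow_le_rpow (by norm_num) hw32 hK₁0
        _ ≤ w ^ (K₁ + K₂) := Real.rpow_le_rpow_of_exponent_le (by linarith) (by linarith)
    have h8 : A * (s / h') ^ q ≤ w ^ (q + K₁ + K₂) := by
      rw [add_assoc, Real.rpow_add (by linarith)]
      have hwq := Real.rpow_pos_of_pos (show 0 < w by linarith) q
      calc A * (s / h') ^ q ≤ A * (2 ^ q * w ^ q) := mul_le_mul_of_nonneg_left h5 hA0.le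
        _ = w ^ q * (A * 2 ^ q) := by ring
        _ ≤ _ := mul_le_mul_of_nonneg_left h7 hwq.le
    have h9 : w ^ (q + K₁ + K₂) ≤ (h / (n * h')) ^ (q + K₁ + K₂) :=
      Real.rpow_le_rpow (by linarith) h6 (by linarith)
    have h10 : 1 + C * (1 + gap / h') ^ q ≤ (h / h') ^ ε * (h / (n * h')) ^ (q + K₁ + K₂) :=
      (h4.trans (h8.trans h9)).trans (le_mul_of_one_le_left (by linarith) hRe)
    exact hfin _ _ hgrow h10
  -- Now the cost is at most the constant `A`. Either $(h/h')^\varepsilon$ already exceeds it, or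
  -- $h/h'\le M$, and then $n\le M$ as well.
  · have h1 : gap / h' ≤ 2 * D := by
      rw [div_le_iff₀ hh']
      linarith [mul_le_mul_of_nonneg_left hcase hD]
    have h2 : (1 + gap / h') ^ q ≤ (1 + 2 * D) ^ q :=
      Real.rpow_le_rpow (by linarith) (by linarith) (by linarith)
    have h3 : 1 + C * (1 + gap / h') ^ q ≤ A := by
      have h3' := mul_le_mul_of_nonneg_left h2 (show 0 ≤ C by linarith)
      rw [hA, add_mul]
      linarith
    by_cases hbig : A ≤ (h / h') ^ ε
    · have h10 : 1 + C * (1 + gap / h') ^ q ≤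
          (h / h') ^ ε * (h / (n * h')) ^ (q + K₁ + K₂) :=
        (h3.trans hbig).trans (le_mul_of_one_le_right (by linarith) hrK)
      exact hfin _ _ hgrow h10
    · have hRM : h / h' ≤ M := by
        by_contra hlt
        push Not at hlt hbig
        have := Real.rpow_lt_rpow hM0.le hlt hε
        rw [hM, ← Real.rpow_mul hA0.le, one_div_mul_cancel hε.ne', Real.rpow_one] at this
        linarith
      rcases le_total gap (τ * h') with hsm | hla
      · have h4 := hF.right b gap h' τ hg hh' hsm
        have h5 : (2 : ℝ) ^ ε ≤ (h / h') ^ ε := Real.rpow_le_rpow (by norm_num) hR2 hε.le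
        have h6 : 1 + ω τ ≤ (h / h') ^ ε * (h / (n * h')) ^ (q + K₁ + K₂) :=
          (show 1 + ω τ ≤ (h / h') ^ ε by linarith).trans
            (le_mul_of_one_le_right (by linarith) hrK)
        exact hfin _ _ h4 h6
      -- A single gap longer than $\tau h'$ among at most `M` children lowers the density to
      -- $h/(nh')\ge 1+\tau/M$, and `K₂` is the power of this that reaches `A`.
      · have hnM : n ≤ M := by
          refine le_trans ?_ hRM
          rw [le_div_iff₀ hh']; linarith
        have h4 : 1 + τ / M ≤ h / (n * h') := by
          rw [le_div_iff₀ hn0]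
          have : τ / M * n ≤ τ := by
            rw [div_mul_eq_mul_div, div_le_iff₀ hM0]
            exact mul_le_mul_of_nonneg_left hnM hτ0.le
          have := mul_le_mul_of_nonneg_right this hh'.le
          rw [add_mul, one_mul, ← mul_assoc]
          linarith
        have h5 : A ≤ (h / (n * h')) ^ (q + K₁ + K₂) := by
          calc A = (1 + τ / M) ^ K₂ := by
                rw [hK₂, Real.rpow_logb (by linarith) (by linarith) hA0]
            _ ≤ (h / (n * h')) ^ K₂ := Real.rpow_le_rpow (by linarith) h4 hK₂0
            _ ≤ _ := Real.rpow_le_rpow_of_exponent_le hr1 (by linarith)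
        have h10 : 1 + C * (1 + gap / h') ^ q ≤
            (h / h') ^ ε * (h / (n * h')) ^ (q + K₁ + K₂) :=
          (h3.trans h5).trans (le_mul_of_one_le_left (by linarith) hRe)
        exact hfin _ _ hgrow h10

/-! ### Trees of hulls and finite mass distribution -/

namespace HomogeneousPerfect

theorem nil_mem_words (n : ℕ → ℕ) : [] ∈ words n 0 := ⟨rfl, fun j hj => by simp at hj⟩

theorem append_mem_words {n : ℕ → ℕ} {k : ℕ} {σ : List ℕ} (hσ : σ ∈ words n k) {j : ℕ}
    (hj : j < n (k + 1)) : σ ++ [j + 1] ∈ words n (k + 1) := by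
  obtain ⟨hl, hw⟩ := hσ
  refine ⟨by simp [hl], fun i hi => ?_⟩
  rw [List.length_append, List.length_singleton] at hi
  rcases (Nat.lt_succ_iff_lt_or_eq.1 hi) with h | h
  · rw [List.getElem_append_left h]
    exact hw i h
  · subst h
    rw [List.getElem_append_right le_rfl]
    simp only [Nat.sub_self, List.getElem_cons_zero, hl]
    omega

theorem exists_of_mem_words_succ {n : ℕ → ℕ} {k : ℕ} {τ : List ℕ} (hτ : τ ∈ words n (k + 1)) :
    ∃ σ ∈ words n k, ∃ j < n (k + 1), τ = σ ++ [j + 1] := by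
  obtain ⟨hl, hw⟩ := hτ
  have hne : τ ≠ [] := by rintro rfl; simp at hl
  have hlast := hw k (by omega)
  have hτe : τ = τ.dropLast ++ [τ[k]'(by omega)] := by
    conv_lhs => rw [← List.dropLast_append_getLast hne]
    rw [List.getLast_eq_getElem]
    congr
    omega
  refine ⟨τ.dropLast, ⟨by simp [hl], fun i hi => ?_⟩, τ[k]'(by omega) - 1, by omega, ?_⟩
  · rw [List.getElem_dropLast]
    exact hw i _
  · rw [Nat.sub_add_cancel hlast.1]
    exact hτe

theorem words_zero (n : ℕ → ℕ) : words n 0 = {[]} := by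
  ext σ
  refine ⟨fun h => List.length_eq_zero_iff.1 h.1, ?_⟩
  rintro rfl
  exact nil_mem_words n

/-- A tree of compact intervals `[lo σ, hi σ]`, of equal length `h k` on level `k`, in which the
children of an interval reach both of its ends, and whose gaps on level `k` exceed `s k` and are at
most `D * (h k + s k)`. -/
structure HullTree (n : ℕ → ℕ) (h s : ℕ → ℝ) (D : ℝ) (lo hi : List ℕ → ℝ) : Prop where
  two_le : ∀ k, 2 ≤ n (k + 1)
  h_pos : ∀ k, 0 < h k
  s_nonneg : ∀ k, 0 ≤ s k
  D_nonneg : 0 ≤ D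
  len : ∀ k, ∀ σ ∈ words n k, hi σ - lo σ = h k
  left : ∀ k, ∀ σ ∈ words n k, lo (σ ++ [1]) = lo σ
  right : ∀ k, ∀ σ ∈ words n k, hi (σ ++ [n (k + 1)]) = hi σ
  gap_lb : ∀ k, ∀ σ ∈ words n k, ∀ i, 1 ≤ i → i + 1 ≤ n (k + 1) →
    s (k + 1) ≤ lo (σ ++ [i + 1]) - hi (σ ++ [i])
  gap_ub : ∀ k, ∀ σ ∈ words n k, ∀ i, 1 ≤ i → i + 1 ≤ n (k + 1) →
    lo (σ ++ [i + 1]) - hi (σ ++ [i]) ≤ D * (h (k + 1) + s (k + 1))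

/-- The left end points of the `N` children of `σ`, followed by the right end point of `σ`. -/
noncomputable def brk (lo hi : List ℕ → ℝ) (N : ℕ) (σ : List ℕ) (j : ℕ) : ℝ :=
  if j < N then lo (σ ++ [j + 1]) else hi σ

/-- The union of the intervals of level `k`. -/
def hullLevel (n : ℕ → ℕ) (lo hi : List ℕ → ℝ) (k : ℕ) : Set ℝ :=
  ⋃ σ ∈ words n k, Set.Icc (lo σ) (hi σ)

/-- The union of the descendants of order `r` of the interval `σ` of level `k`. -/
def leaves (n : ℕ → ℕ) (lo hi : List ℕ → ℝ) : ℕ → ℕ → List ℕ → Set ℝ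
  | 0, _, σ => Set.Icc (lo σ) (hi σ)
  | r + 1, k, σ => ⋃ j ∈ Finset.range (n (k + 1)), leaves n lo hi r (k + 1) (σ ++ [j + 1])

/-- The total weight of the pairs `(i, τ)` where `τ` descends from the word `σ` of level `k`, has
level `lv i < k + r`, and `[u i, v i]` meets the interval of `τ`. -/
noncomputable def load {ι : Type*} (n : ℕ → ℕ) (lo hi : List ℕ → ℝ) (I : Finset ι)
    (u v w : ι → ℝ) (lv : ι → ℕ) : ℕ → ℕ → List ℕ → ℝ
  | 0, _, _ => 0
  | r + 1, k, σ => ∑ i ∈ I with lv i = k ∧ lo σ ≤ v i ∧ u i ≤ hi σ, w i +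
      ∑ j ∈ Finset.range (n (k + 1)), load n lo hi I u v w lv r (k + 1) (σ ++ [j + 1])

namespace HullTree

variable {n : ℕ → ℕ} {h s : ℕ → ℝ} {D : ℝ} {lo hi : List ℕ → ℝ}

theorem lo_lt_hi (H : HullTree n h s D lo hi) {k : ℕ} {σ : List ℕ} (hσ : σ ∈ words n k) :
    lo σ < hi σ := by
  have := H.len k σ hσ
  have := H.h_pos k
  linarith

theorem brk_zero (H : HullTree n h s D lo hi) {k : ℕ} {σ : List ℕ} (hσ : σ ∈ words n k) :
    brk lo hi (n (k + 1)) σ 0 = lo σ := by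
  have := H.two_le k
  rw [brk, if_pos (by omega), zero_add, H.left k σ hσ]

theorem brk_of_lt {N : ℕ} {σ : List ℕ} {j : ℕ} (hj : j < N) :
    brk lo hi N σ j = lo (σ ++ [j + 1]) := if_pos hj

theorem brk_last {N : ℕ} {σ : List ℕ} : brk lo hi N σ N = hi σ := if_neg (lt_irrefl _)

/-- The last block has no gap, since the last child ends where its parent does. -/
theorem gap_nonneg (H : HullTree n h s D lo hi) {k : ℕ} {σ : List ℕ} (hσ : σ ∈ words n k) {j : ℕ}
    (hj : j < n (k + 1)) : hi (σ ++ [j + 1]) ≤ brk lo hi (n (k + 1)) σ (j + 1) := by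
  rcases (Nat.succ_le_of_lt hj).lt_or_eq with h1 | h1
  · have := H.gap_lb k σ hσ (j + 1) (by omega) h1
    have := H.s_nonneg (k + 1)
    rw [brk_of_lt h1]
    linarith
  · rw [← Nat.succ_eq_add_one, h1, brk_last, H.right k σ hσ]

theorem gap_le (H : HullTree n h s D lo hi) {k : ℕ} {σ : List ℕ} (hσ : σ ∈ words n k) {j : ℕ}
    (hj : j < n (k + 1)) : brk lo hi (n (k + 1)) σ (j + 1) - hi (σ ++ [j + 1]) ≤
      D * (h (k + 1) + s (k + 1)) := by
  rcases (Nat.succ_le_of_lt hj).lt_or_eq with h1 | h1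
  · rw [brk_of_lt h1]
    exact H.gap_ub k σ hσ (j + 1) (by omega) h1
  · rw [Nat.succ_eq_add_one] at h1
    rw [h1, brk_last, H.right k σ hσ, sub_self]
    have := H.s_nonneg (k + 1)
    have := H.h_pos (k + 1)
    have := H.D_nonneg
    positivity

theorem brk_le_succ (H : HullTree n h s D lo hi) {k : ℕ} {σ : List ℕ} (hσ : σ ∈ words n k) {j : ℕ}
    (hj : j < n (k + 1)) :
    brk lo hi (n (k + 1)) σ j ≤ brk lo hi (n (k + 1)) σ (j + 1) := by
  rw [brk_of_lt hj]
  exact (H.lo_lt_hi (append_mem_words hσ hj)).le.trans (H.gap_nonneg hσ hj)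

theorem brk_mono (H : HullTree n h s D lo hi) {k : ℕ} {σ : List ℕ} (hσ : σ ∈ words n k) {i j : ℕ}
    (hij : i ≤ j) (hj : j ≤ n (k + 1)) :
    brk lo hi (n (k + 1)) σ i ≤ brk lo hi (n (k + 1)) σ j := by
  induction j, hij using Nat.le_induction with
  | base => exact le_rfl
  | succ j _ ih => exact (ih (by omega)).trans (H.brk_le_succ hσ (by omega))

theorem lo_le_child (H : HullTree n h s D lo hi) {k : ℕ} {σ : List ℕ} (hσ : σ ∈ words n k) {j : ℕ}
    (hj : j < n (k + 1)) : lo σ ≤ lo (σ ++ [j + 1]) := by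
  rw [← H.brk_zero hσ, ← brk_of_lt (lo := lo) (hi := hi) hj]
  exact H.brk_mono hσ (Nat.zero_le _) hj.le

theorem child_le_hi (H : HullTree n h s D lo hi) {k : ℕ} {σ : List ℕ} (hσ : σ ∈ words n k) {j : ℕ}
    (hj : j < n (k + 1)) : hi (σ ++ [j + 1]) ≤ hi σ := by
  refine (H.gap_nonneg hσ hj).trans ?_
  conv_rhs => rw [← brk_last (lo := lo) (hi := hi) (N := n (k + 1))]
  exact H.brk_mono hσ hj le_rfl

theorem sum_brk (H : HullTree n h s D lo hi) {k : ℕ} {σ : List ℕ} (hσ : σ ∈ words n k)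
    (g : ℝ → ℝ) : ∑ j ∈ Finset.range (n (k + 1)),
      (g (brk lo hi (n (k + 1)) σ (j + 1)) - g (brk lo hi (n (k + 1)) σ j)) =
      g (hi σ) - g (lo σ) := by
  rw [Finset.sum_range_sub (fun j => g (brk lo hi (n (k + 1)) σ j)), brk_last, H.brk_zero hσ]

theorem sum_children_le (H : HullTree n h s D lo hi) {k : ℕ} {σ : List ℕ} (hσ : σ ∈ words n k)
    {g : ℝ → ℝ} (hg : Monotone g) : ∑ j ∈ Finset.range (n (k + 1)),
      (g (hi (σ ++ [j + 1])) - g (lo (σ ++ [j + 1]))) ≤ g (hi σ) - g (lo σ) := by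
  rw [← H.sum_brk hσ g]
  refine Finset.sum_le_sum fun j hj => ?_
  rw [Finset.mem_range] at hj
  rw [brk_of_lt hj]
  linarith [hg (H.gap_nonneg hσ hj)]

theorem card_mul_add_gap_le (H : HullTree n h s D lo hi) {k : ℕ} {σ : List ℕ}
    (hσ : σ ∈ words n k) {j : ℕ} (hj : j < n (k + 1)) :
    n (k + 1) * h (k + 1) + (brk lo hi (n (k + 1)) σ (j + 1) - hi (σ ++ [j + 1])) ≤ h k := by
  have h1 := H.sum_brk hσ id
  simp only [id] at h1
  rw [H.len k σ hσ] at h1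
  rw [← h1]
  have h2 : ∀ i ∈ Finset.range (n (k + 1)),
      brk lo hi (n (k + 1)) σ (i + 1) - brk lo hi (n (k + 1)) σ i =
      h (k + 1) + (brk lo hi (n (k + 1)) σ (i + 1) - hi (σ ++ [i + 1])) := fun i hi' => by
    rw [Finset.mem_range] at hi'
    rw [brk_of_lt hi', ← H.len (k + 1) _ (append_mem_words hσ hi')]
    ring
  rw [Finset.sum_congr rfl h2, Finset.sum_add_distrib, Finset.sum_const, Finset.card_range,
    nsmul_eq_mul]
  gcongr
  exact Finset.single_le_sum
    (f := fun i => brk lo hi (n (k + 1)) σ (i + 1) - hi (σ ++ [i + 1]))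
    (fun i hi' => sub_nonneg.2 (H.gap_nonneg hσ (Finset.mem_range.1 hi')))
    (Finset.mem_range.2 hj)

theorem card_mul_add_le (H : HullTree n h s D lo hi) {k : ℕ} {σ : List ℕ} (hσ : σ ∈ words n k) :
    n (k + 1) * h (k + 1) + (n (k + 1) - 1) * s (k + 1) ≤ h k := by
  have h1 := H.sum_brk hσ id
  simp only [id] at h1
  rw [H.len k σ hσ] at h1
  have h0 := H.two_le k
  obtain ⟨m, hm⟩ : ∃ m, n (k + 1) = m + 1 := ⟨n (k + 1) - 1, by omega⟩
  have h2 : ∀ i ∈ Finset.range m, h (k + 1) + s (k + 1) ≤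
      brk lo hi (n (k + 1)) σ (i + 1) - brk lo hi (n (k + 1)) σ i := fun i hi' => by
    rw [Finset.mem_range] at hi'
    have h3 := H.gap_lb k σ hσ (i + 1) (by omega) (by omega)
    have h4 := H.len (k + 1) _ (append_mem_words hσ (j := i) (by omega))
    rw [brk_of_lt (by omega), brk_of_lt (by omega)]
    linarith
  have h5 := Finset.sum_le_sum h2
  rw [Finset.sum_const, Finset.card_range, nsmul_eq_mul] at h5
  have h6 : h (k + 1) ≤ brk lo hi (n (k + 1)) σ (m + 1) - brk lo hi (n (k + 1)) σ m := by
    have h4 := H.len (k + 1) _ (append_mem_words hσ (j := m) (by omega))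
    have h7 := H.gap_nonneg hσ (j := m) (by omega)
    rw [brk_of_lt (j := m) (by omega)]
    linarith
  rw [← h1]
  conv_rhs => rw [hm, Finset.sum_range_succ, ← hm]
  have h8 : (n (k + 1) : ℝ) = m + 1 := by exact_mod_cast hm
  rw [h8]
  rw [← hm] at h6
  rw [add_sub_cancel_right]
  linarith

theorem leaves_subset_Icc (H : HullTree n h s D lo hi) (r : ℕ) : ∀ {k : ℕ} {σ : List ℕ},
    σ ∈ words n k → leaves n lo hi r k σ ⊆ Set.Icc (lo σ) (hi σ) := by
  induction r with
  | zero => intro k σ _; exact subset_rfl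
  | succ r ih =>
    intro k σ hσ
    refine Set.iUnion₂_subset fun j hj => ?_
    rw [Finset.mem_range] at hj
    exact (ih (append_mem_words hσ hj)).trans
      (Set.Icc_subset_Icc (H.lo_le_child hσ hj) (H.child_le_hi hσ hj))

theorem leaves_subset_level (r : ℕ) : ∀ {k : ℕ} {σ : List ℕ},
    σ ∈ words n k → leaves n lo hi r k σ ⊆ hullLevel n lo hi (k + r) := by
  induction r with
  | zero => intro k σ hσ; exact Set.subset_biUnion_of_mem (u := fun σ => Set.Icc (lo σ) (hi σ)) hσ
  | succ r ih =>
    intro k σ hσ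
    refine Set.iUnion₂_subset fun j hj => ?_
    rw [Finset.mem_range] at hj
    have := ih (append_mem_words hσ hj)
    rwa [Nat.add_right_comm, Nat.add_assoc] at this

theorem hullLevel_antitone (H : HullTree n h s D lo hi) : Antitone (hullLevel n lo hi) := by
  refine antitone_nat_of_succ_le fun k => Set.iUnion₂_subset fun τ hτ => ?_
  obtain ⟨σ, hσ, j, hj, rfl⟩ := exists_of_mem_words_succ hτ
  exact (Set.Icc_subset_Icc (H.lo_le_child hσ hj) (H.child_le_hi hσ hj)).trans
    (Set.subset_biUnion_of_mem (u := fun σ => Set.Icc (lo σ) (hi σ)) hσ)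

section Load

variable {ι : Type*} {I : Finset ι} {u v w : ι → ℝ} {lv : ι → ℕ}

/-- Counts by length: a hull of level `lv i` that meets `[u i, v i]` lies in that interval enlarged
by `h (lv i)` on both sides, so it has its full length after clipping. Clipped lengths are
superadditive over the disjoint children, which makes the induction work. -/
theorem load_le (H : HullTree n h s D lo hi) (hw : ∀ i ∈ I, 0 ≤ w i) (r : ℕ) :
    ∀ {k : ℕ} {σ : List ℕ}, σ ∈ words n k → load n lo hi I u v w lv r k σ ≤
      ∑ i ∈ I with k ≤ lv i, w i / h (lv i) *
        (max (u i - h (lv i)) (min (hi σ) (v i + h (lv i))) -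
          max (u i - h (lv i)) (min (lo σ) (v i + h (lv i)))) := by
  classical
  have hmono : ∀ i, Monotone fun x => max (u i - h (lv i)) (min x (v i + h (lv i))) :=
    fun i => monotone_const.max (monotone_id.min monotone_const)
  have hnn : ∀ i ∈ I, ∀ {k σ}, σ ∈ words n k → 0 ≤ w i / h (lv i) *
        (max (u i - h (lv i)) (min (hi σ) (v i + h (lv i))) -
          max (u i - h (lv i)) (min (lo σ) (v i + h (lv i)))) := fun i hi' k σ hσ =>
    mul_nonneg (div_nonneg (hw i hi') (H.h_pos _).le)
      (sub_nonneg.2 (hmono i (H.lo_lt_hi hσ).le))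
  induction r with
  | zero =>
    intro k σ hσ
    exact Finset.sum_nonneg fun i hi' => hnn i (Finset.mem_filter.1 hi').1 hσ
  | succ r ih =>
    intro k σ hσ
    rw [load]
    have hsplit : I.filter (fun i => k ≤ lv i) =
        I.filter (fun i => lv i = k) ∪ I.filter (fun i => k + 1 ≤ lv i) := by
      ext i
      simp only [Finset.mem_filter, Finset.mem_union]
      constructor
      · rintro ⟨h1, h2⟩
        rcases h2.lt_or_eq with h3 | h3
        · exact Or.inr ⟨h1, h3⟩
        · exact Or.inl ⟨h1, h3.symm⟩
      · rintro (⟨h1, h2⟩ | ⟨h1, h2⟩) <;> exact ⟨h1, by omega⟩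
    have hdisj : Disjoint (I.filter (fun i => lv i = k)) (I.filter (fun i => k + 1 ≤ lv i)) := by
      rw [Finset.disjoint_filter]
      intro i _ h1 h2
      omega
    rw [hsplit, Finset.sum_union hdisj]
    refine add_le_add ?_ ?_
    · refine le_trans (Finset.sum_le_sum (g := fun i => w i / h (lv i) *
        (max (u i - h (lv i)) (min (hi σ) (v i + h (lv i))) -
          max (u i - h (lv i)) (min (lo σ) (v i + h (lv i))))) fun i hi' => ?_)
        (Finset.sum_le_sum_of_subset_of_nonneg ?_ fun i hi' _ =>
          hnn i (Finset.mem_filter.1 hi').1 hσ)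
      · obtain ⟨_, hlv, hm1, hm2⟩ := Finset.mem_filter.1 hi'
        have hl := H.len k σ hσ
        have hp := H.h_pos k
        rw [hlv, min_eq_left (by linarith), min_eq_left (by linarith), max_eq_right (by linarith),
          max_eq_right (by linarith), hl, div_mul_cancel₀ _ hp.ne']
      · intro i hi'
        rw [Finset.mem_filter] at hi' ⊢
        exact ⟨hi'.1, hi'.2.1⟩
    · refine (Finset.sum_le_sum fun j hj =>
        ih (append_mem_words hσ (Finset.mem_range.1 hj))).trans ?_
      rw [Finset.sum_comm]
      refine Finset.sum_le_sum fun i hi' => ?_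
      rw [← Finset.mul_sum]
      exact mul_le_mul_of_nonneg_left (H.sum_children_le hσ (hmono i))
        (div_nonneg (hw i (Finset.mem_filter.1 hi').1) (H.h_pos _).le)

theorem load_root_le (H : HullTree n h s D lo hi) (hw : ∀ i ∈ I, 0 ≤ w i)
    (huv : ∀ i ∈ I, u i ≤ v i) (hlv : ∀ i ∈ I, v i - u i ≤ h (lv i)) (r : ℕ) :
    load n lo hi I u v w lv r 0 [] ≤ 3 * ∑ i ∈ I, w i := by
  refine (H.load_le hw r (nil_mem_words n)).trans ?_
  rw [Finset.filter_true_of_mem fun i _ => Nat.zero_le _, Finset.mul_sum]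
  refine Finset.sum_le_sum fun i hi' => ?_
  have hp := H.h_pos (lv i)
  have h1 : max (u i - h (lv i)) (min (hi []) (v i + h (lv i))) ≤ v i + h (lv i) :=
    max_le (by linarith [huv i hi']) (min_le_right _ _)
  have h2 : u i - h (lv i) ≤ max (u i - h (lv i)) (min (lo []) (v i + h (lv i))) :=
    le_max_left _ _
  rw [div_mul_eq_mul_div, div_le_iff₀ hp]
  have := mul_le_mul_of_nonneg_left (show max (u i - h (lv i)) (min (hi []) (v i + h (lv i))) -
    max (u i - h (lv i)) (min (lo []) (v i + h (lv i))) ≤ 3 * h (lv i) by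
      linarith [hlv i hi']) (hw i hi')
  linarith

/-- The mass distribution argument, without a limit measure. The mass of `σ` is split among its
blocks. The share of a child met by a covering set of the same level is charged to that set through
`hcover`. Any other child has its leaves covered by sets of later levels, so `hchild` and the
induction hypothesis apply. -/
theorem le_load (H : HullTree n h s D lo hi) {F : ℝ → ℝ} (hF : StrictMono F) {a : ℕ → ℝ} {d : ℝ}
    (ha : ∀ k, 0 ≤ a k) (hw : ∀ i ∈ I, 0 ≤ w i)
    (hchild : ∀ k, ∀ σ ∈ words n k, ∀ j < n (k + 1),
      a k * (F (hi σ) - F (lo σ)) ^ (d - 1) *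
        (F (brk lo hi (n (k + 1)) σ (j + 1)) - F (brk lo hi (n (k + 1)) σ j)) ≤
      a (k + 1) * (F (hi (σ ++ [j + 1])) - F (lo (σ ++ [j + 1]))) ^ d)
    (hcover : ∀ i ∈ I, ∀ σ ∈ words n (lv i), lo σ ≤ v i → u i ≤ hi σ →
      a (lv i) * (F (hi σ) - F (lo σ)) ^ (d - 1) *
        ∑ j ∈ Finset.range (n (lv i + 1)) with
            lo (σ ++ [j + 1]) ≤ v i ∧ u i ≤ hi (σ ++ [j + 1]),
          (F (brk lo hi (n (lv i + 1)) σ (j + 1)) - F (brk lo hi (n (lv i + 1)) σ j)) ≤ w i)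
    (r : ℕ) : ∀ {k : ℕ} {σ : List ℕ}, σ ∈ words n k → (∀ i ∈ I, lv i < k + r) →
      (∀ x ∈ leaves n lo hi r k σ, ∃ i ∈ I, k ≤ lv i ∧ u i ≤ x ∧ x ≤ v i) →
      a k * (F (hi σ) - F (lo σ)) ^ d ≤ load n lo hi I u v w lv r k σ := by
  have hload0 : ∀ r k σ, 0 ≤ load n lo hi I u v w lv r k σ := by
    intro r
    induction r with
    | zero => intro k σ; exact le_rfl
    | succ r ih =>
      intro k σ
      exact add_nonneg (Finset.sum_nonneg fun i hi' => hw i (Finset.mem_filter.1 hi').1)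
        (Finset.sum_nonneg fun j _ => ih _ _)
  induction r with
  | zero =>
    intro k σ hσ hlt hcov
    -- At depth $0$ the assumptions conflict: a leaf would be covered by a set of level at least
    -- `k`, and all levels are below `k`.
    obtain ⟨i, hiI, hk, _⟩ := hcov (lo σ) ⟨le_rfl, (H.lo_lt_hi hσ).le⟩
    exact absurd (hlt i hiI) (by omega)
  | succ r ih =>
    intro k σ hσ hlt hcov
    have hX : 0 < F (hi σ) - F (lo σ) := sub_pos.2 (hF (H.lo_lt_hi hσ))
    have hc : 0 ≤ a k * (F (hi σ) - F (lo σ)) ^ (d - 1) :=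
      mul_nonneg (ha k) (Real.rpow_nonneg hX.le _)
    set G : Finset ι := I.filter fun i => lv i = k ∧ lo σ ≤ v i ∧ u i ≤ hi σ with hG
    set B : ℕ → ℝ := fun j =>
      F (brk lo hi (n (k + 1)) σ (j + 1)) - F (brk lo hi (n (k + 1)) σ j) with hB
    have hB0 : ∀ j ∈ Finset.range (n (k + 1)), 0 ≤ B j := fun j hj =>
      sub_nonneg.2 (hF.monotone (H.brk_le_succ hσ (Finset.mem_range.1 hj)))
    set Q : ℕ → ℝ := fun j => load n lo hi I u v w lv r (k + 1) (σ ++ [j + 1]) with hQ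
    -- either some set of level `k` meets the child `j`, or the child is covered by later sets
    have hpt : ∀ j ∈ Finset.range (n (k + 1)),
        a k * (F (hi σ) - F (lo σ)) ^ (d - 1) * B j ≤ Q j +
          ∑ i ∈ G, a k * (F (hi σ) - F (lo σ)) ^ (d - 1) *
            if lo (σ ++ [j + 1]) ≤ v i ∧ u i ≤ hi (σ ++ [j + 1]) then B j else 0 := by
      intro j hj
      have hj' := Finset.mem_range.1 hj
      by_cases hd : ∃ i ∈ G, lo (σ ++ [j + 1]) ≤ v i ∧ u i ≤ hi (σ ++ [j + 1])
      · obtain ⟨i, hi1, hi2⟩ := hd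
        have h1 := Finset.single_le_sum (s := G) (f := fun i =>
          a k * (F (hi σ) - F (lo σ)) ^ (d - 1) *
            if lo (σ ++ [j + 1]) ≤ v i ∧ u i ≤ hi (σ ++ [j + 1]) then B j else 0)
          (fun i _ => mul_nonneg hc (by split_ifs; exacts [hB0 j hj, le_rfl])) hi1
        simp only [if_pos hi2] at h1
        linarith [hload0 r (k + 1) (σ ++ [j + 1])]
      · push Not at hd
        have hmem := append_mem_words hσ hj'
        have h1 := ih hmem (fun i hi' => by have := hlt i hi'; omega) (fun x hx => by
          obtain ⟨i, hiI, hk, hx1, hx2⟩ := hcov x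
            (Set.mem_biUnion (s := {j | j ∈ Finset.range (n (k + 1))})
              (t := fun j => leaves n lo hi r (k + 1) (σ ++ [j + 1])) hj hx)
          have hx3 := H.leaves_subset_Icc r hmem hx
          refine ⟨i, hiI, ?_, hx1, hx2⟩
          rcases hk.lt_or_eq with h2 | h2
          · exact h2
          · have hiG : i ∈ G := Finset.mem_filter.2 ⟨hiI, h2.symm,
              (H.lo_le_child hσ hj').trans (hx3.1.trans hx2),
              hx1.trans (hx3.2.trans (H.child_le_hi hσ hj'))⟩
            exact absurd (hx1.trans hx3.2) (not_le.2 (hd i hiG (hx3.1.trans hx2))))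
        have h2 := hchild k σ hσ j hj'
        have h3 : 0 ≤ ∑ i ∈ G, a k * (F (hi σ) - F (lo σ)) ^ (d - 1) *
            if lo (σ ++ [j + 1]) ≤ v i ∧ u i ≤ hi (σ ++ [j + 1]) then B j else 0 :=
          Finset.sum_nonneg fun i _ =>
            mul_nonneg hc (by split_ifs; exacts [hB0 j hj, le_rfl])
        linarith
    have hsum := Finset.sum_le_sum hpt
    rw [← Finset.mul_sum, H.sum_brk hσ F, Finset.sum_add_distrib, Finset.sum_comm] at hsum
    have hpow : (F (hi σ) - F (lo σ)) ^ d =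
        (F (hi σ) - F (lo σ)) ^ (d - 1) * (F (hi σ) - F (lo σ)) := by
      rw [← Real.rpow_add_one hX.ne', sub_add_cancel]
    rw [hpow, ← mul_assoc, load]
    refine hsum.trans ?_
    rw [add_comm]
    gcongr with i hi'
    obtain ⟨hiI, hik, h1, h2⟩ := Finset.mem_filter.1 hi'
    subst hik
    rw [← Finset.mul_sum, ← Finset.sum_filter]
    exact hcover i hiI σ hσ h1 h2

end Load

end HullTree

end HomogeneousPerfect

/-! ### Weights and the lower bound for the content -/

/-- The weight bound for a covering interval of length `w` between the scales `h'` and `h`. -/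
theorem rpow_mul_one_add_div_le {α h h' w s ρ P K q : ℝ} (hh' : 0 < h') (hw : h' ≤ w)
    (hwh : w ≤ h) (hs : 0 ≤ s) (hα : α ≤ 1) (hP : 0 < P) (hPq : P ≤ q) (hqK : q ≤ K)
    (hρ0 : 0 < ρ) (hρ1 : ρ ≤ 1) (hρs : ρ * s ≤ 2 * h')
    (hαρ : α ≤ (h / h') ^ (P / 2) * ρ ^ K) : α * (1 + s / w) ^ q ≤ 4 ^ q * (h / w) ^ P := by
  have hw0 : 0 < w := by linarith
  have hh0 : 0 < h := by linarith
  have hq : 0 < q := by linarith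
  have hhw : 1 ≤ (h / w) ^ P := Real.one_le_rpow (by rwa [le_div_iff₀ hw0, one_mul]) hP.le
  have hsw : 0 ≤ s / w := by positivity
  rcases le_total s w with h1 | h1
  · have h2 : s / w ≤ 1 := by rwa [div_le_one hw0]
    calc α * (1 + s / w) ^ q ≤ 1 * 4 ^ q :=
          mul_le_mul hα (Real.rpow_le_rpow (by linarith) (by linarith) hq.le)
            (by positivity) zero_le_one
      _ ≤ 4 ^ q * (h / w) ^ P := by
          rw [one_mul]; exact le_mul_of_one_le_right (by positivity) hhw
  · have h2 : 1 + s / w ≤ 2 * (s / w) := by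
      have : 1 ≤ s / w := by rwa [le_div_iff₀ hw0, one_mul]
      linarith
    -- For long gaps the density factor $\rho^K$ compensates $(s/w)^q$, because $K\ge q$ and $\rho
    -- s\le 2h'$.
    have h3 : ρ * (2 * (s / w)) ≤ 4 * (h' / w) := by
      have : ρ * (2 * (s / w)) = 2 * (ρ * s) / w := by ring
      rw [this, show 4 * (h' / w) = 4 * h' / w by ring]
      exact div_le_div_of_nonneg_right (by linarith) hw0.le
    have h4 : ρ ^ K ≤ ρ ^ q := Real.rpow_le_rpow_of_exponent_ge hρ0 hρ1 hqK
    have hR : 1 ≤ h / h' := by rw [le_div_iff₀ hh']; linarith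
    have h5 : (h / h') ^ (P / 2) ≤ (h / h') ^ P :=
      Real.rpow_le_rpow_of_exponent_le hR (by linarith)
    have h6 : (h' / w) ^ q ≤ (h' / w) ^ P :=
      Real.rpow_le_rpow_of_exponent_ge (by positivity) (by rwa [div_le_one hw0]) hPq
    calc α * (1 + s / w) ^ q ≤ ((h / h') ^ P * ρ ^ q) * (2 * (s / w)) ^ q := by
          refine mul_le_mul (hαρ.trans (mul_le_mul h5 h4 (by positivity) (by positivity)))
            (Real.rpow_le_rpow (by linarith) h2 hq.le) (by positivity) (by positivity)
      _ = (h / h') ^ P * (ρ * (2 * (s / w))) ^ q := by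
          rw [Real.mul_rpow hρ0.le (by linarith), mul_assoc]
      _ ≤ (h / h') ^ P * (4 * (h' / w)) ^ q := by
          refine mul_le_mul_of_nonneg_left (Real.rpow_le_rpow ?_ h3 hq.le) (by positivity)
          exact mul_nonneg hρ0.le (by linarith)
      _ = 4 ^ q * ((h / h') ^ P * (h' / w) ^ q) := by
          rw [Real.mul_rpow (by norm_num) (by positivity)]; ring
      _ ≤ 4 ^ q * ((h / h') ^ P * (h' / w) ^ P) := by gcongr
      _ = 4 ^ q * (h / w) ^ P := by
          rw [← Real.mul_rpow (by positivity) (by positivity), div_mul_div_cancel₀ hh'.ne']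

theorem AdjacentControl.enlarge_le {F ω : ℝ → ℝ} (hF : AdjacentControl F ω) {a b r : ℝ}
    (hab : a < b) (hr0 : 0 ≤ r) (hr : r ≤ b - a) :
    F (b + r) - F (a - r) ≤ (1 + 2 * ω 1) * (F b - F a) := by
  have h1 := hF.right b r (b - a) 1 hr0 (by linarith) (by linarith)
  have h2 := hF.left a r (b - a) 1 hr0 (by linarith) (by linarith)
  rw [sub_sub_cancel] at h1
  rw [add_sub_cancel] at h2
  linarith

namespace HomogeneousPerfect

namespace HullTree

variable {n : ℕ → ℕ} {h s : ℕ → ℝ} {D : ℝ} {lo hi : List ℕ → ℝ} {F ω : ℝ → ℝ}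

/-- The blocks in question have disjoint interiors and lie in $[u-w,\,v+w+g]$, where $w=v-u\ge
h_{k+1}$ and $g$ bounds the gaps; the growth estimate compares the image of this interval with that
of $[u,v]$. -/
theorem sum_blocks_le (H : HullTree n h s D lo hi) (hF : AdjacentControl F ω) {C q : ℝ}
    (hC : 1 ≤ C) (hq : 1 ≤ q)
    (hgr : ∀ x r r', 0 ≤ r → 0 < r' →
      F (x + r) - F x ≤ C * (1 + r / r') ^ q * (F x - F (x - r')))
    {k : ℕ} {σ : List ℕ} (hσ : σ ∈ words n k) {u v : ℝ} (huv : h (k + 1) ≤ v - u) :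
    ∑ j ∈ Finset.range (n (k + 1)) with lo (σ ++ [j + 1]) ≤ v ∧ u ≤ hi (σ ++ [j + 1]),
      (F (brk lo hi (n (k + 1)) σ (j + 1)) - F (brk lo hi (n (k + 1)) σ j)) ≤
    (1 + ω 1 + C * (2 + D) ^ q) * (1 + s (k + 1) / (v - u)) ^ q * (F v - F u) := by
  have hD := H.D_nonneg
  have hh := H.h_pos (k + 1)
  have hs := H.s_nonneg (k + 1)
  set w := v - u with hw
  have hw0 : 0 < w := by linarith
  set g := D * (h (k + 1) + s (k + 1)) with hg
  have hg0 : 0 ≤ g := by positivity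
  -- Clipping to the enlarged interval fixes the ends of the blocks that count, so the sum may be
  -- extended to all blocks and telescoped.
  set cl : ℝ → ℝ := fun x => max (u - w) (min x (v + (w + g))) with hcl
  have hclm : Monotone cl := monotone_const.max (monotone_id.min monotone_const)
  have hFcl : Monotone fun x => F (cl x) := hF.mono.monotone.comp hclm
  have h1 : ∑ j ∈ Finset.range (n (k + 1)) with lo (σ ++ [j + 1]) ≤ v ∧ u ≤ hi (σ ++ [j + 1]),
      (F (brk lo hi (n (k + 1)) σ (j + 1)) - F (brk lo hi (n (k + 1)) σ j)) ≤
      F (v + (w + g)) - F (u - w) := by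
    calc _ = ∑ j ∈ Finset.range (n (k + 1)) with lo (σ ++ [j + 1]) ≤ v ∧ u ≤ hi (σ ++ [j + 1]),
          (F (cl (brk lo hi (n (k + 1)) σ (j + 1))) - F (cl (brk lo hi (n (k + 1)) σ j))) := by
          refine Finset.sum_congr rfl fun j hj => ?_
          obtain ⟨hj1, hj2, hj3⟩ := Finset.mem_filter.1 hj
          rw [Finset.mem_range] at hj1
          have e1 := H.len (k + 1) _ (append_mem_words hσ hj1)
          have e2 := H.gap_le hσ hj1
          have e3 := H.gap_nonneg hσ hj1
          have c1 : cl (brk lo hi (n (k + 1)) σ (j + 1)) = brk lo hi (n (k + 1)) σ (j + 1) := by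
            rw [hcl]
            simp only
            rw [min_eq_left (by linarith), max_eq_right (by linarith)]
          have c2 : cl (brk lo hi (n (k + 1)) σ j) = brk lo hi (n (k + 1)) σ j := by
            rw [hcl, brk_of_lt hj1]
            simp only
            rw [min_eq_left (by linarith), max_eq_right (by linarith)]
          rw [c1, c2]
      _ ≤ ∑ j ∈ Finset.range (n (k + 1)),
          (F (cl (brk lo hi (n (k + 1)) σ (j + 1))) - F (cl (brk lo hi (n (k + 1)) σ j))) :=
          Finset.sum_le_sum_of_subset_of_nonneg (Finset.filter_subset _ _) fun j hj _ =>
            sub_nonneg.2 (hFcl (H.brk_le_succ hσ (Finset.mem_range.1 hj)))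
      _ = F (cl (hi σ)) - F (cl (lo σ)) := H.sum_brk hσ fun x => F (cl x)
      _ ≤ F (v + (w + g)) - F (u - w) :=
          sub_le_sub (hF.mono.monotone (max_le (by linarith) (min_le_right _ _)))
            (hF.mono.monotone (le_max_left _ _))
  have h2 := hgr v (w + g) w (by linarith) hw0
  have h3 := hF.left u w w 1 hw0.le hw0 (by linarith)
  rw [show v - w = u by rw [hw]; ring] at h2
  rw [show u + w = v by rw [hw]; ring] at h3
  have hy : 0 ≤ F v - F u := sub_nonneg.2 (hF.mono.monotone (by linarith))
  have hsw : 0 ≤ s (k + 1) / w := by positivity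
  have h4 : 1 + (w + g) / w ≤ (2 + D) * (1 + s (k + 1) / w) := by
    have e1 : (w + g) / w = 1 + D * (h (k + 1) / w + s (k + 1) / w) := by
      rw [hg]; field_simp
    have e2 : h (k + 1) / w ≤ 1 := by rwa [div_le_one hw0]
    have e3 := mul_le_mul_of_nonneg_left e2 hD
    rw [e1]
    linarith
  have h5 : (1 + (w + g) / w) ^ q ≤ (2 + D) ^ q * (1 + s (k + 1) / w) ^ q := by
    rw [← Real.mul_rpow (by linarith) (by linarith)]
    exact Real.rpow_le_rpow (by positivity) h4 (by linarith)
  have h6 : 1 ≤ (1 + s (k + 1) / w) ^ q := Real.one_le_rpow (by linarith) (by linarith)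
  have hω := hF.pos 1 one_pos
  have h7 : 1 + ω 1 + C * (1 + (w + g) / w) ^ q ≤
      (1 + ω 1 + C * (2 + D) ^ q) * (1 + s (k + 1) / w) ^ q := by
    have e1 := mul_le_mul_of_nonneg_left h5 (show 0 ≤ C by linarith)
    have e2 := mul_le_mul_of_nonneg_left h6 (show 0 ≤ 1 + ω 1 by linarith)
    linarith
  have h8 := mul_le_mul_of_nonneg_right h7 hy
  linarith

/-- The interval lies in the hull of `σ` enlarged by its own length on both sides; the Hölder bound
applies there, and the enlargement costs a constant factor. -/
theorem image_le_of_meets (H : HullTree n h s D lo hi) (hF : AdjacentControl F ω) {p : ℝ}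
    (hp : 0 < p) (hhol : ∀ a a' b b' : ℝ, a < a' → b ≤ a → a' ≤ b' →
      2 * (a' - a) ≤ b' - b → F a' - F a ≤ ((a' - a) / (b' - b)) ^ p * (F b' - F b))
    {k : ℕ} {σ : List ℕ} (hσ : σ ∈ words n k) {u v : ℝ} (huv : u < v) (hle : v - u ≤ h k)
    (h1 : lo σ ≤ v) (h2 : u ≤ hi σ) :
    F v - F u ≤ (1 + 2 * ω 1) * (F (hi σ) - F (lo σ)) * ((v - u) / h k) ^ p := by
  have hl := H.len k σ hσ
  have hh := H.h_pos k
  have e1 := hF.enlarge_le (H.lo_lt_hi hσ) hh.le hl.ge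
  have e2 := hhol u v (lo σ - h k) (hi σ + h k) huv (by linarith) (by linarith) (by linarith)
  have e3 : ((v - u) / (hi σ + h k - (lo σ - h k))) ^ p ≤ ((v - u) / h k) ^ p := by
    refine Real.rpow_le_rpow (div_nonneg (by linarith) (by linarith)) ?_ hp.le
    exact div_le_div_of_nonneg_left (by linarith) hh (by linarith)
  have hX : 0 ≤ F (hi σ + h k) - F (lo σ - h k) :=
    sub_nonneg.2 (hF.mono.monotone (by linarith))
  calc F v - F u ≤ _ := e2
    _ ≤ ((v - u) / h k) ^ p * ((1 + 2 * ω 1) * (F (hi σ) - F (lo σ))) :=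
        mul_le_mul e3 e1 hX (Real.rpow_nonneg (div_nonneg (by linarith) hh.le) _)
    _ = _ := by ring

theorem words_finite (n : ℕ → ℕ) (k : ℕ) : (words n k).Finite := by
  induction k with
  | zero => rw [words_zero]; exact Set.finite_singleton _
  | succ k ih =>
    refine ((ih.prod (Set.finite_Iio (n (k + 1)))).image
      fun x : List ℕ × ℕ => x.1 ++ [x.2 + 1]).subset fun τ hτ => ?_
    obtain ⟨σ, hσ, j, hj, rfl⟩ := exists_of_mem_words_succ hτ
    exact ⟨(σ, j), ⟨hσ, hj⟩, rfl⟩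

theorem isCompact_hullLevel (n : ℕ → ℕ) (lo hi : List ℕ → ℝ) (k : ℕ) :
    IsCompact (hullLevel n lo hi k) :=
  (words_finite n k).isCompact_biUnion fun _ _ => isCompact_Icc

theorem exists_scale {h : ℕ → ℝ} (htend : Filter.Tendsto h Filter.atTop (nhds 0)) {w : ℝ}
    (hw : 0 < w) (hw0 : w < h 0) : ∃ l, h (l + 1) ≤ w ∧ w ≤ h l := by
  classical
  have hex : ∃ m, h m ≤ w := ((htend.eventually (gt_mem_nhds hw)).exists).imp fun _ => le_of_lt
  obtain ⟨l, hl⟩ : ∃ l, Nat.find hex = l + 1 := by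
    refine Nat.exists_eq_succ_of_ne_zero fun h0 => ?_
    have := Nat.find_spec hex
    rw [h0] at this
    linarith
  exact ⟨l, hl ▸ Nat.find_spec hex, (not_le.1 (Nat.find_min hex (m := l) (by omega))).le⟩

/-- If the intervals of level `k` can be weighted so that the weights dominate along children and
along covering intervals, then finite covers of the limit set have large `d`-dimensional content
under `F`. -/
theorem exists_content_of_weights (H : HullTree n h s D lo hi) (hF : AdjacentControl F ω) {d : ℝ}
    (hd : 0 < d) (htend : Filter.Tendsto h Filter.atTop (nhds 0)) {a : ℕ → ℝ} (ha : ∀ k, 0 < a k)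
    (hchild : ∀ k, ∀ σ ∈ words n k, ∀ j < n (k + 1),
      a k * (F (hi σ) - F (lo σ)) ^ (d - 1) *
        (F (brk lo hi (n (k + 1)) σ (j + 1)) - F (brk lo hi (n (k + 1)) σ j)) ≤
      a (k + 1) * (F (hi (σ ++ [j + 1])) - F (lo (σ ++ [j + 1]))) ^ d)
    (hcover : ∀ k, ∀ σ ∈ words n k, ∀ u v : ℝ, h (k + 1) ≤ v - u → v - u ≤ h k → lo σ ≤ v →
      u ≤ hi σ → a k * (F (hi σ) - F (lo σ)) ^ (d - 1) *
        ∑ j ∈ Finset.range (n (k + 1)) with lo (σ ++ [j + 1]) ≤ v ∧ u ≤ hi (σ ++ [j + 1]),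
          (F (brk lo hi (n (k + 1)) σ (j + 1)) - F (brk lo hi (n (k + 1)) σ j)) ≤
        (F v - F u) ^ d) :
    ∃ κ, 0 < κ ∧ ∀ {ι : Type} (I : Finset ι) (u v : ι → ℝ), (∀ i ∈ I, u i < v i) →
      (⋂ k, hullLevel n lo hi k) ⊆ ⋃ i ∈ I, Set.Ioo (u i) (v i) →
      κ ≤ ∑ i ∈ I, (F (v i) - F (u i)) ^ d := by
  classical
  have hω := hF.pos 1 one_pos
  have hX : 0 < F (hi []) - F (lo []) := sub_pos.2 (hF.mono (H.lo_lt_hi (nil_mem_words n)))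
  have hlen := H.len 0 [] (nil_mem_words n)
  -- The first bound serves when some covering interval is as long as the root. The second is the
  -- mass of the root, divided by the multiplicity $3$ of `load_root_le`.
  refine ⟨min (((F (hi []) - F (lo [])) / (1 + 2 * ω 1)) ^ d)
    (a 0 * (F (hi []) - F (lo [])) ^ d / 3), lt_min (by positivity)
    (div_pos (mul_pos (ha 0) (by positivity)) three_pos), ?_⟩
  intro ι I u v huv hcov
  set I' := I.filter fun i => lo [] ≤ v i ∧ u i ≤ hi [] with hI'
  have hy : ∀ i ∈ I, 0 ≤ (F (v i) - F (u i)) ^ d := fun i hi' =>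
    Real.rpow_nonneg (sub_nonneg.2 (hF.mono.monotone (huv i hi').le)) _
  have hy' : ∀ i ∈ I', 0 ≤ (F (v i) - F (u i)) ^ d := fun i hi' =>
    hy i (Finset.mem_filter.1 hi').1
  have hII' : ∑ i ∈ I', (F (v i) - F (u i)) ^ d ≤ ∑ i ∈ I, (F (v i) - F (u i)) ^ d :=
    Finset.sum_le_sum_of_subset_of_nonneg (Finset.filter_subset _ _) fun i hi' _ => hy i hi'
  refine le_trans ?_ hII'
  by_cases hbig : ∃ i ∈ I', h 0 ≤ v i - u i
  · obtain ⟨i, hi', hle⟩ := hbig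
    refine (min_le_left _ _).trans (le_trans ?_ (Finset.single_le_sum hy' hi'))
    obtain ⟨hiI, h1, h2⟩ := Finset.mem_filter.1 hi'
    refine Real.rpow_le_rpow (by positivity) ?_ hd.le
    rw [div_le_iff₀ (by linarith), mul_comm]
    refine le_trans ?_ (hF.enlarge_le (huv i hiI) (sub_pos.2 (huv i hiI)).le le_rfl)
    exact sub_le_sub (hF.mono.monotone (by linarith)) (hF.mono.monotone (by linarith))
  · push Not at hbig
    have hlv : ∀ i, ∃ l, i ∈ I' → h (l + 1) ≤ v i - u i ∧ v i - u i ≤ h l := fun i => by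
      by_cases hi' : i ∈ I'
      · obtain ⟨l, hl⟩ := exists_scale htend
          (sub_pos.2 (huv i (Finset.mem_filter.1 hi').1)) (hbig i hi')
        exact ⟨l, fun _ => hl⟩
      · exact ⟨0, fun h => absurd h hi'⟩
    choose lv hlv using hlv
    obtain ⟨m, hm⟩ : ∃ m, hullLevel n lo hi m ⊆ ⋃ i ∈ I, Set.Ioo (u i) (v i) := by
      refine exists_subset_nhds_of_isCompact' (directed_of_isDirected_le H.hullLevel_antitone)
        (isCompact_hullLevel n lo hi) (fun k => (isCompact_hullLevel n lo hi k).isClosed)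
        fun x hx => ?_
      exact (isOpen_biUnion fun i _ => isOpen_Ioo).mem_nhds (hcov hx)
    -- Deep enough that level `R` is covered, by compactness, and that every covering interval has a
    -- level below `R`.
    set R := max m (I'.sup lv + 1) with hR
    have hlow := H.le_load (I := I') (u := u) (v := v) (w := fun i => (F (v i) - F (u i)) ^ d)
      (lv := lv) (d := d) hF.mono (fun k => (ha k).le) hy' hchild
      (fun i hi' σ hσ h1 h2 => hcover _ σ hσ _ _ (hlv i hi').1 (hlv i hi').2 h1 h2) R
      (nil_mem_words n) (fun i hi' => by have := Finset.le_sup (f := lv) hi'; omega)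
      (fun x hx => by
        have h1 := H.leaves_subset_Icc R (nil_mem_words n) hx
        have h2 := leaves_subset_level R (nil_mem_words n) hx
        rw [zero_add] at h2
        obtain ⟨i, hi', h3⟩ := Set.mem_iUnion₂.1 (hm (H.hullLevel_antitone (le_max_left _ _) h2))
        exact ⟨i, Finset.mem_filter.2 ⟨hi', h1.1.trans h3.2.le, h3.1.le.trans h1.2⟩,
          Nat.zero_le _, h3.1.le, h3.2.le⟩)
    have hup := H.load_root_le (I := I') (u := u) (v := v)
      (w := fun i => (F (v i) - F (u i)) ^ d) (lv := lv) hy'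
      (fun i hi' => (huv i (Finset.mem_filter.1 hi').1).le) (fun i hi' => (hlv i hi').2) R
    refine (min_le_right _ _).trans ?_
    rw [div_le_iff₀ three_pos]
    linarith

/-- Covers of the limit set have `d`-dimensional content bounded from below under `F` for `d < 1`,
if the numbers of intervals in the tree are those of a set of dimension `1`. -/
theorem exists_content (H : HullTree n h s D lo hi) (hF : AdjacentControl F ω) {d : ℝ}
    (hd : 0 < d) (hd1 : d < 1) (htend : Filter.Tendsto h Filter.atTop (nhds 0))
    (hdim : ∀ t : ℝ, 0 < t → t < 1 → ∃ κ, 0 < κ ∧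
      ∀ k, κ ≤ (∏ i ∈ Finset.range k, (n (i + 1) : ℝ)) * h k ^ t) :
    ∃ κ, 0 < κ ∧ ∀ {ι : Type} (I : Finset ι) (u v : ι → ℝ), (∀ i ∈ I, u i < v i) →
      (⋂ k, hullLevel n lo hi k) ⊆ ⋃ i ∈ I, Set.Ioo (u i) (v i) →
      κ ≤ ∑ i ∈ I, (F (v i) - F (u i)) ^ d := by
  obtain ⟨C, q, hC, hq, hgr⟩ := hF.exists_growth
  obtain ⟨p, hp, hp1, hhol⟩ := hF.exists_holder
  set P := p * (1 - d) with hPdef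
  have hP : 0 < P := mul_pos hp (by linarith)
  have hP1 : P ≤ 1 := mul_le_one₀ hp1 (by linarith) (by linarith)
  -- Half of the gain exponent `P` goes to the gaps; the other half offsets the loss of density.
  obtain ⟨K, hqK, hloss⟩ := hF.exists_gap_loss hC hq H.D_nonneg (half_pos hP) hgr
  have hK : 0 < K := by linarith
  have hω := hF.pos 1 one_pos
  have ht1 : P / 2 / K < 1 := by rw [div_lt_one hK]; linarith
  have ht0 : 0 < P / 2 / K := by positivity
  -- This exponent gives $N_kh_k\ge\kappa\,h_k^{P/(2K)}$, which is exactly $b_k\le1$ below.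
  obtain ⟨κ, hκ, hκN⟩ := hdim (1 - P / 2 / K) (by linarith) (by linarith)
  set N : ℕ → ℝ := fun k => ∏ i ∈ Finset.range k, (n (i + 1) : ℝ) with hN
  have hn : ∀ k, (0 : ℝ) < n (k + 1) := fun k => by
    have := H.two_le k
    exact_mod_cast (by omega : 0 < n (k + 1))
  have hN0 : ∀ k, 0 < N k := fun k => Finset.prod_pos fun i _ => hn i
  have hNs : ∀ k, N (k + 1) = N k * n (k + 1) := fun k => Finset.prod_range_succ _ _
  set C₁ := 1 + ω 1 + C * (2 + D) ^ q with hC₁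
  have hC₁0 : 0 < C₁ := by have := H.D_nonneg; positivity
  set C₂ := 1 + 2 * ω 1 with hC₂
  have hC₂0 : 0 < C₂ := by positivity
  set b : ℕ → ℝ := fun k => κ ^ K * (h k ^ (P / 2) / (N k * h k) ^ K) with hb
  have hb0 : ∀ k, 0 < b k := fun k => by
    have := H.h_pos k
    have := hN0 k
    positivity
  have hb1 : ∀ k, b k ≤ 1 := fun k => by
    have hh := H.h_pos k
    have hNk := hN0 k
    rw [hb]
    simp only
    rw [← mul_div_assoc, div_le_one (by positivity)]
    have h1 : κ * h k ^ (P / 2 / K) ≤ N k * h k := by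
      have h2 := mul_le_mul_of_nonneg_right (hκN k)
        (Real.rpow_nonneg hh.le (P / 2 / K))
      rwa [mul_assoc, ← Real.rpow_add hh, sub_add_cancel, Real.rpow_one] at h2
    have h3 := Real.rpow_le_rpow (by positivity) h1 hK.le
    rwa [Real.mul_rpow hκ.le (by positivity), ← Real.rpow_mul hh.le,
      div_mul_cancel₀ _ hK.ne'] at h3
  -- The recursion that balances gain against loss; the formula for `b` is its solution.
  have hbs : ∀ k, b k = b (k + 1) *
      ((h k / h (k + 1)) ^ (P / 2) * (n (k + 1) * h (k + 1) / h k) ^ K) := fun k => by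
    have hh := H.h_pos k
    have hh' := H.h_pos (k + 1)
    have hNk := hN0 k
    have hnk := hn k
    rw [hb]
    simp only
    rw [hNs, Real.div_rpow hh.le hh'.le, Real.div_rpow (by positivity) hh.le,
      Real.mul_rpow hNk.le hh.le, Real.mul_rpow (by positivity) hh'.le,
      Real.mul_rpow hNk.le hnk.le, Real.mul_rpow hnk.le hh'.le]
    field_simp
  -- Absorbs the constants of the three estimates for a covering interval. It cancels in the
  -- condition on children.
  set κ₀ := (C₁ * C₂ ^ (1 - d) * 4 ^ q)⁻¹ with hκ₀
  have hκ₀0 : 0 < κ₀ := by positivity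
  refine H.exists_content_of_weights hF hd htend (a := fun k => κ₀ * b k)
    (fun k => mul_pos hκ₀0 (hb0 k)) ?_ ?_
  · intro k σ hσ j hj
    have hh := H.h_pos k
    have hh' := H.h_pos (k + 1)
    have hnk := hn k
    have hτ := append_mem_words hσ hj
    have hX : 0 < F (hi σ) - F (lo σ) := sub_pos.2 (hF.mono (H.lo_lt_hi hσ))
    have hx : 0 < F (hi (σ ++ [j + 1])) - F (lo (σ ++ [j + 1])) :=
      sub_pos.2 (hF.mono (H.lo_lt_hi hτ))
    have hl' := H.len (k + 1) _ hτ
    have hgap := hloss (n (k + 1)) (h (k + 1)) (h k) (s (k + 1))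
      (brk lo hi (n (k + 1)) σ (j + 1) - hi (σ ++ [j + 1])) (hi (σ ++ [j + 1])) (H.two_le k) hh'
      (H.s_nonneg _) (sub_nonneg.2 (H.gap_nonneg hσ hj)) (H.gap_le hσ hj)
      (H.card_mul_add_gap_le hσ hj) (H.card_mul_add_le hσ)
    rw [add_sub_cancel, show hi (σ ++ [j + 1]) - h (k + 1) = lo (σ ++ [j + 1]) by linarith] at hgap
    rw [brk_of_lt hj]
    have h2h : 2 * h (k + 1) ≤ h k := by
      have e1 := H.card_mul_add_gap_le hσ hj
      have e2 := H.gap_nonneg hσ hj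
      have e3 : (2 : ℝ) ≤ n (k + 1) := by exact_mod_cast H.two_le k
      have e4 := mul_le_mul_of_nonneg_right e3 hh'.le
      linarith
    have hhol' := hhol _ _ _ _ (H.lo_lt_hi hτ) (H.lo_le_child hσ hj) (H.child_le_hi hσ hj)
      (by rw [hl', H.len k σ hσ]; exact h2h)
    rw [hl', H.len k σ hσ] at hhol'
    set X := F (hi σ) - F (lo σ)
    set x := F (hi (σ ++ [j + 1])) - F (lo (σ ++ [j + 1]))
    have hpow : X ^ (d - 1) * (h k / h (k + 1)) ^ P ≤ x ^ (d - 1) := by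
      have e1 := Real.rpow_le_rpow_of_nonpos hx hhol' (show d - 1 ≤ 0 by linarith)
      rw [Real.mul_rpow (by positivity) hX.le, ← Real.rpow_mul (by positivity)] at e1
      have e2 : (h (k + 1) / h k) ^ (p * (d - 1)) = (h k / h (k + 1)) ^ P := by
        rw [← inv_div, Real.inv_rpow (by positivity), ← Real.rpow_neg (by positivity), hPdef]
        congr 1
        ring
      rw [e2] at e1
      linarith
    have hxd : x ^ d = x ^ (d - 1) * x := by rw [← Real.rpow_add_one hx.ne', sub_add_cancel]
    have hbT : b k * ((h k / h (k + 1)) ^ (P / 2) * (h k / (n (k + 1) * h (k + 1))) ^ K) =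
        b (k + 1) * (h k / h (k + 1)) ^ P := by
      have e1 : (h k / h (k + 1)) ^ P =
          (h k / h (k + 1)) ^ (P / 2) * (h k / h (k + 1)) ^ (P / 2) := by
        rw [← Real.rpow_add (by positivity), add_halves]
      have e2 : (n (k + 1) * h (k + 1) / h k) ^ K * (h k / (n (k + 1) * h (k + 1))) ^ K = 1 := by
        rw [← Real.mul_rpow (by positivity) (by positivity), div_mul_div_cancel₀ hh.ne',
          div_self (by positivity), Real.one_rpow]
      rw [hbs, e1]
      linear_combination (b (k + 1) * (h k / h (k + 1)) ^ (P / 2) *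
        (h k / h (k + 1)) ^ (P / 2)) * e2
    have hcoef : 0 ≤ κ₀ * b k * X ^ (d - 1) :=
      mul_nonneg (mul_nonneg hκ₀0.le (hb0 k).le) (Real.rpow_nonneg hX.le _)
    calc _ ≤ κ₀ * b k * X ^ (d - 1) *
          ((h k / h (k + 1)) ^ (P / 2) * (h k / (n (k + 1) * h (k + 1))) ^ K * x) :=
          mul_le_mul_of_nonneg_left hgap hcoef
      _ = κ₀ * b (k + 1) * (X ^ (d - 1) * (h k / h (k + 1)) ^ P) * x := by
          linear_combination (κ₀ * X ^ (d - 1) * x) * hbT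
      _ ≤ κ₀ * b (k + 1) * x ^ (d - 1) * x := by
          refine mul_le_mul_of_nonneg_right (mul_le_mul_of_nonneg_left hpow ?_) hx.le
          exact mul_nonneg hκ₀0.le (hb0 _).le
      _ = _ := by rw [hxd]; ring
  · intro k σ hσ u v huv hvu h1 h2
    have hh := H.h_pos k
    have hh' := H.h_pos (k + 1)
    have hs := H.s_nonneg (k + 1)
    have hnk := hn k
    have hw0 : 0 < v - u := by linarith
    have hX : 0 < F (hi σ) - F (lo σ) := sub_pos.2 (hF.mono (H.lo_lt_hi hσ))
    have hy : 0 < F v - F u := sub_pos.2 (hF.mono (by linarith))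
    have hblocks := H.sum_blocks_le hF hC hq hgr hσ huv
    have himg := H.image_le_of_meets hF hp hhol hσ (by linarith) hvu h1 h2
    have hcard := H.card_mul_add_le hσ
    have hn2 : (2 : ℝ) ≤ n (k + 1) := by exact_mod_cast H.two_le k
    have hns : 0 ≤ (n (k + 1) - 2) * s (k + 1) := mul_nonneg (by linarith) hs
    have hscal := rpow_mul_one_add_div_le (α := b k) (h := h k) (h' := h (k + 1)) (w := v - u)
      (s := s (k + 1)) (ρ := n (k + 1) * h (k + 1) / h k) (P := P) (K := K) (q := q) hh' huv hvu hs
      (hb1 k) hP (by linarith) hqK (by positivity)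
      (by rw [div_le_one hh]; linarith)
      (by
        rw [div_mul_eq_mul_div, div_le_iff₀ hh]
        have : n (k + 1) * s (k + 1) ≤ 2 * h k := by
          have := mul_pos hnk hh'
          linarith
        have := mul_le_mul_of_nonneg_right this hh'.le
        linarith)
      (by
        rw [hbs]
        exact mul_le_of_le_one_left (by positivity) (hb1 _))
    set X := F (hi σ) - F (lo σ)
    set y := F v - F u
    set w := v - u
    have hpow : C₂ ^ (d - 1) * X ^ (d - 1) * (h k / w) ^ P ≤ y ^ (d - 1) := by
      have e1 := Real.rpow_le_rpow_of_nonpos hy himg (show d - 1 ≤ 0 by linarith)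
      rw [Real.mul_rpow (by positivity) (by positivity), Real.mul_rpow hC₂0.le hX.le,
        ← Real.rpow_mul (by positivity)] at e1
      have e2 : (w / h k) ^ (p * (d - 1)) = (h k / w) ^ P := by
        rw [← inv_div, Real.inv_rpow (by positivity), ← Real.rpow_neg (by positivity), hPdef]
        congr 1
        ring
      rwa [e2] at e1
    have hyd : y ^ d = y ^ (d - 1) * y := by rw [← Real.rpow_add_one hy.ne', sub_add_cancel]
    have hC₂d : C₂ ^ (1 - d) * C₂ ^ (d - 1) = 1 := by
      rw [← Real.rpow_add hC₂0, show (1 - d + (d - 1)) = 0 by ring, Real.rpow_zero]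
    have hκ₀' : κ₀ * C₁ * 4 ^ q = C₂ ^ (d - 1) := by
      have e1 : κ₀ * (C₁ * C₂ ^ (1 - d) * 4 ^ q) = 1 := inv_mul_cancel₀ (by positivity)
      linear_combination (C₂ ^ (d - 1)) * e1 - (κ₀ * C₁ * 4 ^ q) * hC₂d
    have hcoef : 0 ≤ κ₀ * b k * X ^ (d - 1) :=
      mul_nonneg (mul_nonneg hκ₀0.le (hb0 k).le) (Real.rpow_nonneg hX.le _)
    calc _ ≤ κ₀ * b k * X ^ (d - 1) * (C₁ * (1 + s (k + 1) / w) ^ q * y) :=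
          mul_le_mul_of_nonneg_left hblocks hcoef
      _ = κ₀ * X ^ (d - 1) * C₁ * y * (b k * (1 + s (k + 1) / w) ^ q) := by ring
      _ ≤ κ₀ * X ^ (d - 1) * C₁ * y * (4 ^ q * (h k / w) ^ P) :=
          mul_le_mul_of_nonneg_left hscal (by positivity)
      _ = C₂ ^ (d - 1) * X ^ (d - 1) * (h k / w) ^ P * y := by
          rw [← hκ₀']; ring
      _ ≤ y ^ (d - 1) * y := mul_le_mul_of_nonneg_right hpow hy.le
      _ = y ^ d := hyd.symm

end HullTree

end HomogeneousPerfect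

/-! ### From content to dimension, and from dimension to counting -/

/-- A lower bound for the `d`-dimensional content of the image of a compact set of reals is a lower
bound for the Hausdorff dimension of the image. -/
theorem le_dimH_image_of_content {g : ℝ ≃ₜ ℝ} (hg : StrictMono g) {S : Set ℝ} (hS : IsCompact S)
    {d : ℝ≥0} (hd : 0 < d) (hd1 : d ≤ 1) {κ : ℝ} (hκ : 0 < κ)
    (hcont : ∀ (I : Finset ℕ) (u v : ℕ → ℝ), (∀ i ∈ I, u i < v i) →
      S ⊆ ⋃ i ∈ I, Set.Ioo (u i) (v i) → κ ≤ ∑ i ∈ I, (g (v i) - g (u i)) ^ (d : ℝ)) :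
    (d : ENNReal) ≤ dimH (g '' S) := by
  refine le_dimH_of_hausdorffMeasure_ne_zero fun h0 => ?_
  have hd' : (0 : ℝ) < d := hd
  have hκ2 : ENNReal.ofReal (κ / 2) ≠ 0 := by
    rw [Ne, ENNReal.ofReal_eq_zero]; linarith
  rw [Measure.hausdorffMeasure_apply] at h0
  -- Scale $1$ is enough: zero measure gives covers of small sum at this scale, and its diameter
  -- bound makes the sets bounded.
  have h1 := le_iSup₂ (f := fun (r : ENNReal) (_ : 0 < r) =>
    ⨅ (t : ℕ → Set ℝ) (_ : g '' S ⊆ ⋃ n, t n) (_ : ∀ n, Metric.ediam (t n) ≤ r),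
      ∑' n, ⨆ _ : (t n).Nonempty, Metric.ediam (t n) ^ (d : ℝ)) 1 zero_lt_one
  rw [h0] at h1
  have h2 := lt_of_le_of_lt h1 (pos_iff_ne_zero.2 hκ2)
  simp only [iInf_lt_iff] at h2
  obtain ⟨t, hcov, hdiam, hsum⟩ := h2
  obtain ⟨ε, hε0, hε⟩ := ENNReal.exists_pos_sum_of_countable hκ2 ℕ
  have hbdd : ∀ n, Bornology.IsBounded (t n) := fun n => by
    rw [Metric.isBounded_iff_ediam_ne_top]
    exact ne_top_of_le_ne_top ENNReal.one_ne_top (hdiam n)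
  -- The sets are widened to open intervals. The total widening is $\varepsilon_n^{1/d}$, and
  -- $x\mapsto x^d$ is subadditive, so the sum grows by at most $\varepsilon_n$.
  set ρ : ℕ → ℝ := fun n => (ε n : ℝ) ^ (1 / (d : ℝ)) / 2 with hρ
  have hρ0 : ∀ n, 0 < ρ n := fun n => by
    have : (0 : ℝ) < ε n := hε0 n
    positivity
  set a : ℕ → ℝ := fun n => sInf (t n) - ρ n with ha
  set b : ℕ → ℝ := fun n => sSup (t n) + ρ n with hb
  have hΔ : ∀ n, 0 ≤ sSup (t n) - sInf (t n) := fun n =>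
    sub_nonneg.2 (Real.sInf_le_sSup _ (hbdd n).bddBelow (hbdd n).bddAbove)
  have hab : ∀ n, a n < b n := fun n => by
    have := hΔ n
    have := hρ0 n
    simp only [ha, hb]
    linarith
  have htab : ∀ n, t n ⊆ Set.Ioo (a n) (b n) := fun n x hx => by
    have h3 := csInf_le (hbdd n).bddBelow hx
    have h4 := le_csSup (hbdd n).bddAbove hx
    have := hρ0 n
    constructor <;> simp only [ha, hb] <;> linarith
  have hterm : ∀ n, ENNReal.ofReal ((b n - a n) ^ (d : ℝ)) ≤
      (⨆ _ : (t n).Nonempty, Metric.ediam (t n) ^ (d : ℝ)) + ε n := fun n => by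
    have h3 : (b n - a n) ^ (d : ℝ) ≤ (sSup (t n) - sInf (t n)) ^ (d : ℝ) + ε n := by
      have h4 : b n - a n = (sSup (t n) - sInf (t n)) + (ε n : ℝ) ^ (1 / (d : ℝ)) := by
        simp only [ha, hb, hρ]; ring
      rw [h4]
      refine (Real.rpow_add_le_add_rpow (hΔ n) (by positivity) hd'.le hd1).trans ?_
      rw [← Real.rpow_mul (NNReal.coe_nonneg _), one_div_mul_cancel hd'.ne', Real.rpow_one]
    refine (ENNReal.ofReal_le_ofReal h3).trans ?_
    rw [ENNReal.ofReal_add (Real.rpow_nonneg (hΔ n) _) (NNReal.coe_nonneg _),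
      ENNReal.ofReal_coe_nnreal]
    gcongr
    rcases (t n).eq_empty_or_nonempty with he | hne
    -- Infimum and supremum of the empty set are both $0$ by convention, so an empty set contributes
    -- nothing.
    · rw [he, Real.sSup_empty, Real.sInf_empty, sub_self, Real.zero_rpow hd'.ne',
        ENNReal.ofReal_zero]
      exact zero_le (a := _)
    · rw [iSup_pos hne, Real.ediam_eq (hbdd n), ENNReal.ofReal_rpow_of_nonneg (hΔ n) hd'.le]
  have hScov : S ⊆ ⋃ n, Set.Ioo (g.symm (a n)) (g.symm (b n)) := fun x hx => by
    obtain ⟨n, hn⟩ := Set.mem_iUnion.1 (hcov (Set.mem_image_of_mem g hx))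
    have h3 := htab n hn
    refine Set.mem_iUnion.2 ⟨n, ?_, ?_⟩
    · rw [← hg.lt_iff_lt, g.apply_symm_apply]; exact h3.1
    · rw [← hg.lt_iff_lt, g.apply_symm_apply]; exact h3.2
  obtain ⟨I, hI⟩ := hS.elim_finite_subcover _ (fun n => isOpen_Ioo) hScov
  have h3 := hcont I (fun n => g.symm (a n)) (fun n => g.symm (b n)) (fun n _ => by
    rw [← hg.lt_iff_lt, g.apply_symm_apply, g.apply_symm_apply]; exact hab n) hI
  simp only [g.apply_symm_apply] at h3
  have h4 : ENNReal.ofReal κ < ENNReal.ofReal κ := by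
    calc ENNReal.ofReal κ ≤ ENNReal.ofReal (∑ i ∈ I, (b i - a i) ^ (d : ℝ)) :=
          ENNReal.ofReal_le_ofReal h3
      _ = ∑ i ∈ I, ENNReal.ofReal ((b i - a i) ^ (d : ℝ)) :=
          ENNReal.ofReal_sum_of_nonneg fun i _ => Real.rpow_nonneg (sub_nonneg.2 (hab i).le) _
      _ ≤ ∑ i ∈ I, ((⨆ _ : (t i).Nonempty, Metric.ediam (t i) ^ (d : ℝ)) + ε i) :=
          Finset.sum_le_sum fun i _ => hterm i
      _ ≤ ∑' i, ((⨆ _ : (t i).Nonempty, Metric.ediam (t i) ^ (d : ℝ)) + ε i) :=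
          ENNReal.sum_le_tsum I
      _ = ∑' i, (⨆ _ : (t i).Nonempty, Metric.ediam (t i) ^ (d : ℝ)) + ∑' i, (ε i : ENNReal) :=
          ENNReal.tsum_add
      _ < ENNReal.ofReal (κ / 2) + ENNReal.ofReal (κ / 2) := ENNReal.add_lt_add hsum hε
      _ = ENNReal.ofReal κ := by
          rw [← ENNReal.ofReal_add (by linarith) (by linarith), add_halves]
  exact lt_irrefl _ h4

namespace HomogeneousPerfect

theorem ncard_words_le (n : ℕ → ℕ) (k : ℕ) :
    (words n k).ncard ≤ ∏ i ∈ Finset.range k, n (i + 1) := by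
  induction k with
  | zero => rw [words_zero]; simp
  | succ k ih =>
    have hsub : words n (k + 1) ⊆ (fun x : List ℕ × ℕ => x.1 ++ [x.2 + 1]) ''
        (words n k ×ˢ Set.Iio (n (k + 1))) := fun τ hτ => by
      obtain ⟨σ, hσ, j, hj, rfl⟩ := exists_of_mem_words_succ hτ
      exact ⟨(σ, j), ⟨hσ, hj⟩, rfl⟩
    have hfin : (words n k ×ˢ Set.Iio (n (k + 1))).Finite :=
      (HullTree.words_finite n k).prod (Set.finite_Iio _)
    refine (Set.ncard_le_ncard hsub (hfin.image _)).trans ((Set.ncard_image_le hfin).trans ?_)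
    rw [Set.ncard_prod, Finset.prod_range_succ, ← Finset.coe_Iio, Set.ncard_coe_finset,
      Nat.card_Iio]
    gcongr

/-- If a set of dimension at least `1` lies in all levels of a tree of intervals, then the number of
intervals is large compared with their lengths. -/
theorem HullTree.exists_le_card_mul_rpow {n : ℕ → ℕ} {h s : ℕ → ℝ} {D : ℝ} {lo hi : List ℕ → ℝ}
    (H : HullTree n h s D lo hi) {E : Set ℝ} (hE : ∀ k, E ⊆ hullLevel n lo hi k)
    (hdim : 1 ≤ dimH E) {t : ℝ} (ht : 0 < t) (ht1 : t < 1) :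
    ∃ κ, 0 < κ ∧ ∀ k, κ ≤ (∏ i ∈ Finset.range k, (n (i + 1) : ℝ)) * h k ^ t := by
  by_contra hcon
  push Not at hcon
  have hN1 : ∀ k, (1 : ℝ) ≤ ∏ i ∈ Finset.range k, (n (i + 1) : ℝ) := fun k => by
    have : 1 ≤ ∏ i ∈ Finset.range k, n (i + 1) := Finset.one_le_prod' fun i _ => by
      have := H.two_le i
      omega
    exact_mod_cast this
  -- Along these levels $N_kh_k^t\to0$. As $N_k\ge1$, the lengths tend to $0$ too, so the levels are
  -- fine covers showing that the `t`-dimensional measure of `E` vanishes, against $t<1\le\dim_H E$.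
  choose k hk using fun m : ℕ => hcon (1 / ((m : ℝ) + 1)) Nat.one_div_pos_of_nat
  have hht : ∀ m, h (k m) ^ t ≤ 1 / ((m : ℝ) + 1) := fun m =>
    (le_mul_of_one_le_left (Real.rpow_nonneg (H.h_pos _).le _) (hN1 _)).trans (hk m).le
  have hlim := tendsto_one_div_add_atTop_nhds_zero_nat (𝕜 := ℝ)
  have hhlim : Filter.Tendsto (fun m => h (k m)) Filter.atTop (nhds 0) := by
    have h1 : Filter.Tendsto (fun m : ℕ => (1 / ((m : ℝ) + 1)) ^ (1 / t)) Filter.atTop (nhds 0) := by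
      have := hlim.rpow_const (p := 1 / t) (Or.inr (by positivity))
      rwa [Real.zero_rpow (by positivity)] at this
    refine squeeze_zero (fun m => (H.h_pos _).le) (fun m => ?_) h1
    have := Real.rpow_le_rpow (Real.rpow_nonneg (H.h_pos _).le _) (hht m)
      (show 0 ≤ 1 / t by positivity)
    rwa [← Real.rpow_mul (H.h_pos _).le, mul_one_div_cancel ht.ne', Real.rpow_one] at this
  have : ∀ m, Fintype (words n (k m)) := fun m => (words_finite n (k m)).fintype
  have hdm : ∀ m, ∀ σ : words n (k m), Metric.ediam (Set.Icc (lo σ) (hi σ)) =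
      ENNReal.ofReal (h (k m)) := fun m σ => by
    rw [Real.ediam_Icc, H.len _ _ σ.2]
  have hmeas := Measure.hausdorffMeasure_le_liminf_sum (X := ℝ) t E (l := Filter.atTop)
    (ι := fun m => words n (k m)) (fun m => ENNReal.ofReal (h (k m)))
    (by simpa using ENNReal.tendsto_ofReal hhlim) (fun m σ => Set.Icc (lo σ) (hi σ))
    (Filter.Eventually.of_forall fun m σ => (hdm m σ).le)
    (Filter.Eventually.of_forall fun m => by
      have := hE (k m)
      rw [hullLevel, Set.biUnion_eq_iUnion] at this
      exact this)
  have hsum : ∀ m, ∑ σ : words n (k m), Metric.ediam (Set.Icc (lo σ) (hi σ)) ^ t ≤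
      ENNReal.ofReal (1 / ((m : ℝ) + 1)) := fun m => by
    simp only [hdm]
    rw [Finset.sum_const, Finset.card_univ, nsmul_eq_mul, ← Nat.card_eq_fintype_card,
      Nat.card_coe_set_eq, ENNReal.ofReal_rpow_of_pos (H.h_pos _), ← ENNReal.ofReal_natCast,
      ← ENNReal.ofReal_mul (Nat.cast_nonneg _)]
    refine ENNReal.ofReal_le_ofReal (le_trans ?_ (hk m).le)
    refine mul_le_mul_of_nonneg_right ?_ (Real.rpow_nonneg (H.h_pos _).le _)
    exact_mod_cast ncard_words_le n (k m)
  have hzero : μH[t] E = 0 := by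
    refine le_antisymm (hmeas.trans ?_) (zero_le (a := _))
    refine (Filter.liminf_le_liminf (Filter.Eventually.of_forall hsum)).trans ?_
    have := (ENNReal.tendsto_ofReal hlim).liminf_eq
    rw [this, ENNReal.ofReal_zero]
  have h1 := dimH_le_of_hausdorffMeasure_ne_top (d := t.toNNReal) (s := E)
    (by rw [Real.coe_toNNReal _ ht.le, hzero]; exact ENNReal.zero_ne_top)
  have h2 : (1 : ℝ≥0) ≤ t.toNNReal := by exact_mod_cast hdim.trans h1
  rw [Real.one_le_toNNReal] at h2
  linarith

/-- The quasisymmetric images of the limit set of a tree of hulls have dimension `1`, if the limit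
set has. -/
theorem HullTree.dimH_image_eq_one {n : ℕ → ℕ} {h s : ℕ → ℝ} {D : ℝ} {lo hi : List ℕ → ℝ}
    (H : HullTree n h s D lo hi) (htend : Filter.Tendsto h Filter.atTop (nhds 0))
    (hdim : dimH (⋂ k, hullLevel n lo hi k) = 1) {f : ℝ ≃ₜ ℝ} (hf : IsQuasisymmetric f) :
    dimH (f '' ⋂ k, hullLevel n lo hi k) = 1 := by
  obtain ⟨g, hg, hgq, hgf⟩ := hf.exists_strictMono
  rw [← hgf]
  obtain ⟨ω, hω⟩ := hgq.exists_adjacentControl hg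
  refine le_antisymm ((dimH_mono (Set.subset_univ _)).trans Real.dimH_univ.le) ?_
  have hcomp : IsCompact (⋂ k, hullLevel n lo hi k) :=
    (isCompact_hullLevel n lo hi 0).of_isClosed_subset
      (isClosed_iInter fun k => (isCompact_hullLevel n lo hi k).isClosed) (Set.iInter_subset _ 0)
  refine le_of_forall_lt fun x hx => ?_
  obtain ⟨d, hxd, hd1⟩ := ENNReal.lt_iff_exists_nnreal_btwn.1 hx
  have hd1' : d < 1 := by exact_mod_cast hd1
  refine lt_of_lt_of_le hxd ?_
  have hd0 : 0 < d := by
    have := (zero_le (a := x)).trans_lt hxd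
    exact_mod_cast this
  obtain ⟨κ, hκ, hcont⟩ := H.exists_content hω (d := d) (by exact_mod_cast hd0)
    (by exact_mod_cast hd1') htend
    fun t ht ht1 => H.exists_le_card_mul_rpow (fun k => Set.iInter_subset _ k) hdim.ge ht ht1
  exact le_dimH_image_of_content hg hcomp hd0 hd1'.le hκ fun I u v => hcont I u v

/-! ### Passing from basic intervals to hulls -/

/-- The common length `c 1 * ⋯ * c k` of the basic intervals of order `k`. -/
noncomputable def basicLen (c : ℕ → ℝ) (k : ℕ) : ℝ := ∏ i ∈ Finset.Icc 1 k, c i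

/-- The distance from the left end of a basic interval of order `k` to the limit set. -/
noncomputable def leftMargin (η : ℕ → ℕ → ℝ) (k : ℕ) : ℝ := ∑' j, η (k + j + 1) 0

/-- The distance from the right end of a basic interval of order `k` to the limit set. -/
noncomputable def rightMargin (n : ℕ → ℕ) (η : ℕ → ℕ → ℝ) (k : ℕ) : ℝ :=
  ∑' j, η (k + j + 1) (n (k + j + 1))

theorem basicLen_succ (c : ℕ → ℝ) (k : ℕ) : basicLen c (k + 1) = basicLen c k * c (k + 1) :=
  Finset.prod_Icc_succ_top (by omega) _

namespace IsStructure

variable {n : ℕ → ℕ} {c : ℕ → ℝ} {η : ℕ → ℕ → ℝ} {J : List ℕ → NonemptyInterval ℝ}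

theorem basicLen_pos (hJ : IsStructure n c η J) (k : ℕ) : 0 < basicLen c k :=
  Finset.prod_pos fun i hi => hJ.c_pos i (Finset.mem_Icc.1 hi).1

theorem len_eq (hJ : IsStructure n c η J) (k : ℕ) : ∀ σ ∈ words n k, len (J σ) = basicLen c k := by
  induction k with
  | zero =>
    intro σ hσ
    rw [words_zero, Set.mem_singleton_iff] at hσ
    subst hσ
    simp [len, hJ.root_fst, hJ.root_snd, basicLen]
  | succ k ih =>
    intro τ hτ
    obtain ⟨σ, hσ, j, hj, rfl⟩ := exists_of_mem_words_succ hτ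
    have h1 := hJ.ratio k σ hσ (j + 1) (by omega) hj
    rw [ih σ hσ, div_eq_iff (hJ.basicLen_pos k).ne'] at h1
    rw [h1, basicLen_succ, mul_comm]

theorem exists_mem_words (hJ : IsStructure n c η J) (k : ℕ) : ∃ σ, σ ∈ words n k := by
  induction k with
  | zero => exact ⟨[], nil_mem_words n⟩
  | succ k ih =>
    obtain ⟨σ, hσ⟩ := ih
    exact ⟨_, append_mem_words hσ (j := 0) (by have := hJ.two_le_n (k + 1) (by omega); omega)⟩

/-- Two children with disjoint interiors and both outer gaps fit into the parent. Iteration makes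
the margins summable, the lengths at most $2^{-k}$ and the hulls nondegenerate. -/
theorem margins_add_le (hJ : IsStructure n c η J) (k : ℕ) :
    η (k + 1) 0 + η (k + 1) (n (k + 1)) + 2 * basicLen c (k + 1) ≤ basicLen c k := by
  obtain ⟨σ, hσ⟩ := hJ.exists_mem_words k
  have h2 := hJ.two_le_n (k + 1) (by omega)
  have hlen : ∀ j, j < n (k + 1) →
      (J (σ ++ [j + 1])).snd - (J (σ ++ [j + 1])).fst = basicLen c (k + 1) :=
    fun j hj => hJ.len_eq (k + 1) _ (append_mem_words hσ hj)
  have hpos := hJ.basicLen_pos (k + 1)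
  have hchain : ∀ j, 2 ≤ j → j ≤ n (k + 1) → (J (σ ++ [1])).snd ≤ (J (σ ++ [j])).fst := by
    intro j hj
    induction j, hj using Nat.le_induction with
    | base => exact fun h => hJ.ordered k σ hσ 1 le_rfl h
    | succ j hj ih =>
      intro h
      have e1 := ih (by omega)
      have e2 := hJ.ordered k σ hσ j (by omega) h
      have e3 := hlen (j - 1) (by omega)
      rw [Nat.sub_add_cancel (by omega)] at e3
      linarith
  have h3 := hchain (n (k + 1)) h2 le_rfl
  have h4 := hlen 0 (by omega)
  have h5 := hlen (n (k + 1) - 1) (by omega)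
  rw [Nat.sub_add_cancel (by omega)] at h5
  rw [zero_add] at h4
  have h6 := hJ.len_eq k σ hσ
  rw [len] at h6
  have h7 := hJ.gap_left k σ hσ
  have h8 := hJ.gap_right k σ hσ
  linarith

theorem sum_margins_le (hJ : IsStructure n c η J) (k m : ℕ) :
    ∑ j ∈ Finset.range m, (η (k + j + 1) 0 + η (k + j + 1) (n (k + j + 1))) ≤
      basicLen c k - basicLen c (k + m) := by
  induction m with
  | zero => simp
  | succ m ih =>
    rw [Finset.sum_range_succ]
    have h1 := hJ.margins_add_le (k + m)
    have h2 := hJ.basicLen_pos (k + m + 1)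
    rw [← add_assoc k m 1]
    linarith

theorem summable_left (hJ : IsStructure n c η J) (k : ℕ) :
    Summable fun j => η (k + j + 1) 0 := by
  refine summable_of_sum_range_le (c := basicLen c k)
    (fun j => hJ.gap_nonneg _ _ (by omega) (by omega)) fun m => ?_
  have h1 := hJ.sum_margins_le k m
  rw [Finset.sum_add_distrib] at h1
  have h2 : 0 ≤ ∑ j ∈ Finset.range m, η (k + j + 1) (n (k + j + 1)) :=
    Finset.sum_nonneg fun j _ => hJ.gap_nonneg _ _ (by omega) le_rfl
  have h3 := hJ.basicLen_pos (k + m)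
  linarith

theorem summable_right (hJ : IsStructure n c η J) (k : ℕ) :
    Summable fun j => η (k + j + 1) (n (k + j + 1)) := by
  refine summable_of_sum_range_le (c := basicLen c k)
    (fun j => hJ.gap_nonneg _ _ (by omega) le_rfl) fun m => ?_
  have h1 := hJ.sum_margins_le k m
  rw [Finset.sum_add_distrib] at h1
  have h2 : 0 ≤ ∑ j ∈ Finset.range m, η (k + j + 1) 0 :=
    Finset.sum_nonneg fun j _ => hJ.gap_nonneg _ _ (by omega) (by omega)
  have h3 := hJ.basicLen_pos (k + m)
  linarith

theorem leftMargin_nonneg (hJ : IsStructure n c η J) (k : ℕ) : 0 ≤ leftMargin η k :=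
  tsum_nonneg fun _ => hJ.gap_nonneg _ _ (by omega) (by omega)

theorem rightMargin_nonneg (hJ : IsStructure n c η J) (k : ℕ) : 0 ≤ rightMargin n η k :=
  tsum_nonneg fun _ => hJ.gap_nonneg _ _ (by omega) le_rfl

theorem leftMargin_eq (hJ : IsStructure n c η J) (k : ℕ) :
    leftMargin η k = η (k + 1) 0 + leftMargin η (k + 1) := by
  rw [leftMargin, (hJ.summable_left k).tsum_eq_zero_add, leftMargin]
  congr 1
  exact tsum_congr fun j => by rw [show k + (j + 1) + 1 = k + 1 + j + 1 by ring]

theorem rightMargin_eq (hJ : IsStructure n c η J) (k : ℕ) :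
    rightMargin n η k = η (k + 1) (n (k + 1)) + rightMargin n η (k + 1) := by
  rw [rightMargin, (hJ.summable_right k).tsum_eq_zero_add, rightMargin]
  congr 1
  exact tsum_congr fun j => by rw [show k + (j + 1) + 1 = k + 1 + j + 1 by ring]

theorem margins_le (hJ : IsStructure n c η J) (k : ℕ) :
    leftMargin η k + rightMargin n η k ≤ basicLen c k := by
  rw [leftMargin, rightMargin, ← (hJ.summable_left k).tsum_add (hJ.summable_right k)]
  refine Real.tsum_le_of_sum_range_le (fun j => add_nonneg
    (hJ.gap_nonneg _ _ (by omega) (by omega)) (hJ.gap_nonneg _ _ (by omega) le_rfl)) fun m => ?_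
  have := hJ.sum_margins_le k m
  have := hJ.basicLen_pos (k + m)
  linarith

theorem margins_lt (hJ : IsStructure n c η J) (k : ℕ) :
    leftMargin η k + rightMargin n η k < basicLen c k := by
  have h1 := hJ.margins_le (k + 1)
  have h2 := hJ.margins_add_le k
  have h3 := hJ.basicLen_pos (k + 1)
  rw [hJ.leftMargin_eq k, hJ.rightMargin_eq k]
  linarith

theorem tendsto_basicLen (hJ : IsStructure n c η J) :
    Filter.Tendsto (basicLen c) Filter.atTop (nhds 0) := by
  have hle : ∀ k, basicLen c k ≤ (1 / 2 : ℝ) ^ k := by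
    intro k
    induction k with
    | zero => simp [basicLen]
    | succ k ih =>
      have h1 := hJ.margins_add_le k
      have h2 := hJ.gap_nonneg (k + 1) 0 (by omega) (by omega)
      have h3 := hJ.gap_nonneg (k + 1) (n (k + 1)) (by omega) le_rfl
      rw [pow_succ]
      linarith
  exact squeeze_zero (fun k => (hJ.basicLen_pos k).le) hle
    (tendsto_pow_atTop_nhds_zero_of_lt_one (by norm_num) (by norm_num))

/-- Under either gap condition the interior gaps of order `k`, widened by the margins, lie between
`s k` and a multiple of the sum of `s k` and the length of the hulls. -/
theorem exists_gap_bounds (hJ : IsStructure n c η J)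
    (hAB : GapsComparable n η ∨ GapsDominated n c η) :
    ∃ (s : ℕ → ℝ) (D : ℝ), 0 ≤ D ∧ (∀ k, 0 ≤ s k) ∧ ∀ k, 1 ≤ k → ∀ i, 1 ≤ i → i < n k →
      s k ≤ η k i + leftMargin η k + rightMargin n η k ∧
      η k i + leftMargin η k + rightMargin n η k ≤
        D * (basicLen c k - leftMargin η k - rightMargin n η k + s k) := by
  have hL := hJ.leftMargin_nonneg
  have hR := hJ.rightMargin_nonneg
  rcases hAB with ⟨C, hC, hA⟩ | ⟨D, hD, hB⟩
  · have hC0 : 0 < C := by linarith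
    -- Under (A) every interior gap lies between $\eta_{k,1}/C$ and $C^2$ times this. The maximum
    -- with $0$ matters only at the meaningless index $k=0$.
    refine ⟨fun k => leftMargin η k + rightMargin n η k + max 0 (η k 1 / C), C * C, by positivity,
      fun k => add_nonneg (add_nonneg (hL k) (hR k)) (le_max_left _ _), fun k hk i hi hin => ?_⟩
    have hn2 := hJ.two_le_n k hk
    constructor
    · have h1 : max 0 (η k 1 / C) ≤ η k i := by
        refine max_le (hJ.gap_nonneg k i hk hin.le) ?_
        rw [div_le_iff₀ hC0, mul_comm]
        exact hA k hk 1 i le_rfl (by omega) hi hin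
      linarith
    · have h1 : η k i ≤ C * C * max 0 (η k 1 / C) := by
        refine (hA k hk i 1 hi hin le_rfl (by omega)).trans ?_
        have : C * η k 1 = C * C * (η k 1 / C) := by field_simp
        rw [this]
        exact mul_le_mul_of_nonneg_left (le_max_right _ _) (by positivity)
      have h2 : 1 ≤ C * C := one_le_mul_of_one_le_of_one_le hC hC
      have h3 := mul_le_mul_of_nonneg_right h2 (add_nonneg (hL k) (hR k))
      have h4 := mul_nonneg (show 0 ≤ C * C by positivity) (sub_pos.2 (hJ.margins_lt k)).le
      linarith
  -- Under (B) the margins alone serve as `s k`: added to the hull length they restore the basic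
  -- length, which controls the gaps.
  · refine ⟨fun k => leftMargin η k + rightMargin n η k, D + 1, by linarith,
      fun k => add_nonneg (hL k) (hR k), fun k hk i hi hin => ⟨?_, ?_⟩⟩
    · linarith [hJ.gap_nonneg k i hk hin.le]
    · have h1 : η k i ≤ D * basicLen c k := hB k hk i hi hin
      have h2 := hJ.margins_le k
      simp only
      rw [show basicLen c k - leftMargin η k - rightMargin n η k +
        (leftMargin η k + rightMargin n η k) = basicLen c k by ring]
      linarith

/-- The convex hulls of the parts of the limit set in the basic intervals form a tree of hulls. -/
theorem exists_hullTree (hJ : IsStructure n c η J)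
    (hAB : GapsComparable n η ∨ GapsDominated n c η) :
    ∃ (s : ℕ → ℝ) (D : ℝ), HullTree n
      (fun k => basicLen c k - leftMargin η k - rightMargin n η k) s D
      (fun σ => (J σ).fst + leftMargin η σ.length)
      (fun σ => (J σ).snd - rightMargin n η σ.length) := by
  obtain ⟨s, D, hD, hs, hgap⟩ := hJ.exists_gap_bounds hAB
  refine ⟨s, D, ?_⟩
  have hl : ∀ {k σ}, σ ∈ words n k → ∀ i, (σ ++ [i]).length = k + 1 := fun hσ i => by
    rw [List.length_append, List.length_singleton, hσ.1]
  constructor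
  · exact fun k => hJ.two_le_n (k + 1) (by omega)
  · intro k
    linarith [hJ.margins_lt k]
  · exact hs
  · exact hD
  · intro k σ hσ
    have := hJ.len_eq k σ hσ
    rw [len] at this
    simp only [hσ.1]
    linarith
  · intro k σ hσ
    have := hJ.gap_left k σ hσ
    simp only [hl hσ, hσ.1, hJ.leftMargin_eq k]
    linarith
  · intro k σ hσ
    have := hJ.gap_right k σ hσ
    simp only [hl hσ, hσ.1, hJ.rightMargin_eq k]
    linarith
  · intro k σ hσ i hi hin
    have h1 := hJ.gap_interior k σ hσ i hi hin
    have h2 := (hgap (k + 1) (by omega) i hi hin).1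
    simp only [hl hσ]
    linarith
  · intro k σ hσ i hi hin
    have h1 := hJ.gap_interior k σ hσ i hi hin
    have h2 := (hgap (k + 1) (by omega) i hi hin).2
    simp only [hl hσ]
    linarith

/-- A point of $E$ is within $c_1\cdots c_m$ of some hull of order $m$, for every $m$, and the
levels of the hull tree are decreasing and closed. -/
theorem limitSet_eq (hJ : IsStructure n c η J) {h s : ℕ → ℝ} {D : ℝ}
    (H : HullTree n h s D (fun σ => (J σ).fst + leftMargin η σ.length)
      (fun σ => (J σ).snd - rightMargin n η σ.length)) :
    limitSet n J = ⋂ k, hullLevel n (fun σ => (J σ).fst + leftMargin η σ.length)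
      (fun σ => (J σ).snd - rightMargin n η σ.length) k := by
  refine Set.Subset.antisymm (Set.subset_iInter fun k x hx => ?_) ?_
  · refine Metric.mem_of_closed' (HullTree.isCompact_hullLevel _ _ _ k).isClosed |>.2 fun ε hε => ?_
    obtain ⟨m, hm, hkm⟩ := ((hJ.tendsto_basicLen.eventually (gt_mem_nhds hε)).and
      (Filter.eventually_ge_atTop k)).exists
    obtain ⟨τ, hτ, hxτ⟩ := Set.mem_iUnion₂.1 (Set.mem_iInter.1 hx m)
    have h1 := hJ.len_eq m τ hτ
    rw [len] at h1
    have h2 := H.lo_lt_hi hτ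
    have h3 := hJ.leftMargin_nonneg τ.length
    have h4 := hJ.rightMargin_nonneg τ.length
    refine ⟨(J τ).fst + leftMargin η τ.length,
      H.hullLevel_antitone hkm (Set.mem_iUnion₂.2 ⟨τ, hτ, le_rfl, h2.le⟩), ?_⟩
    rw [Real.dist_eq, abs_lt]
    constructor <;> linarith [hxτ.1, hxτ.2]
  · refine Set.iInter_mono fun k => Set.iUnion₂_mono fun σ _ => Set.Icc_subset_Icc ?_ ?_
    · linarith [hJ.leftMargin_nonneg σ.length]
    · linarith [hJ.rightMargin_nonneg σ.length]

end IsStructure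

end HomogeneousPerfect

/-! ### Conclusion -/

theorem theorem2 (n : ℕ → ℕ) (c : ℕ → ℝ) (η : ℕ → ℕ → ℝ)
    (J : List ℕ → NonemptyInterval ℝ)
    (hJ : HomogeneousPerfect.IsStructure n c η J)
    (hdim : dimH (HomogeneousPerfect.limitSet n J) = 1)
    (hAB : HomogeneousPerfect.GapsComparable n η ∨ HomogeneousPerfect.GapsDominated n c η) :
    IsQuasisymmetricallyMinimal (HomogeneousPerfect.limitSet n J) ∧
      ∀ f : ℝ ≃ₜ ℝ, IsQuasisymmetric f →
        dimH (f '' HomogeneousPerfect.limitSet n J) = 1 := by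
  obtain ⟨s, D, H⟩ := hJ.exists_hullTree hAB
  have htend : Filter.Tendsto (fun k => HomogeneousPerfect.basicLen c k -
      HomogeneousPerfect.leftMargin η k - HomogeneousPerfect.rightMargin n η k)
      Filter.atTop (nhds 0) :=
    squeeze_zero (fun k => (H.h_pos k).le) (fun k => by
      linarith [hJ.leftMargin_nonneg k, hJ.rightMargin_nonneg k]) hJ.tendsto_basicLen
  have key : ∀ f : ℝ ≃ₜ ℝ, IsQuasisymmetric f →
      dimH (f '' HomogeneousPerfect.limitSet n J) = 1 := fun f hf => by
    rw [hJ.limitSet_eq H] at hdim ⊢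
    exact H.dimH_image_eq_one htend hdim hf
  exact ⟨fun f hf => by rw [hdim, key f hf], key⟩
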